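/- Let $q$ be a power of a prime, $A=\mathbb{F}_q[\theta]$, $k=\mathbb{F}_q(\theta)$, $k_\infty=\mathbb{F}_q((1/\theta))$ its completion at the infinite place, and $\mathbb{C}_\infty$ the completion of an algebraic closure of $k_\infty$, with absolute value normalised by $|\theta|_\infty=q$. For $d\ge 0$ and $s\ge 1$ put $S_d(s)=\sum_{a\in A \text{ monic},\ \deg a=d}a^{-s}$, and for $\mathfrak{s}=(s_1,\dots,s_r)$ with all $s_j\ge 1$ put $$\zeta_A(s_1,\dots,s_r)=\sum \frac{1}{a_1^{s_1}\cdots a_r^{s_r}}\in k_\infty,$$ the sum being over $r$-tuples of monic polynomials in $A$ with $\deg a_1>\cdots>\deg a_r$. Put $\mathcal{L}_i=\prod_{j=1}^{i}(\theta-\theta^{q^j})$ and $$\mathrm{Li}_{\mathfrak{s}}(z_1,\dots,z_r)=\sum_{i_1>\cdots>i_r\ge 0}\frac{z_1^{q^{i_1}}\cdots z_r^{q^{i_r}}}{\mathcal{L}_{i_1}^{s_1}\cdots\mathcal{L}_{i_r}^{s_r}},$$ with $\mathbb{D}_{\mathfrak{s}}\subseteq\mathbb{C}_\infty^r$ the set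 of points where this series converges. Put $D_n=\prod_{i=0}^{n-1}(\theta^{q^n}-\theta^{q^i})$ and $\Gamma_{n+1}=\prod_i D_i^{n_i}$, where $n=\sum_i n_iq^i$ is the base $q$ expansion of $n\ge 0$. Fix $\tilde\theta\in\mathbb{C}_\infty$ with $\tilde\theta^{\,q-1}=-\theta$, and put $\Omega(t)=\tilde\theta^{-q}\prod_{i\ge 1}(1-t/\theta^{q^i})$ and $\tilde\pi=1/\Omega(\theta)$. For a power series $f=\sum_i a_it^i$ over $\mathbb{C}_\infty$ write $f^{(d)}=\sum_i a_i^{q^d}t^i$. Then: 1. There is a sequence of polynomials $H_n(t)\in A[t]$, $n=0,1,2,\dots$ (the Anderson–Thakur polynomials), such that $$\left(H_{s-1}\Omega^s\right)^{(d)}(\theta)=\frac{\Gamma_s S_d(s)}{\tilde\pi^s}\qquad\text{for all } d\ge 0 \text{ and } s\ge 1.$$ 2. Let $(H_n)$ be any such sequence. Then $\deg_\theta H_n\le nq/(q-1)$ for every $n\ge 0$. Let $\mathfrak{s}=(s_1,\dots,s_r)$ with all $s_j\ge 1$. For each tuple $m=(m_1,\dots,m_r)$ with $0\le m_j\le\deg_t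 H_{s_j-1}$, let $u_m=(u_1,\dots,u_r)\in A^r$ be the point whose coordinate $u_j$ is the coefficient of $t^{m_j}$ in $H_{s_j-1}$, and let $a_m=\theta^{m_1+\cdots+m_r}$. Then the series defining $\zeta_A(s_1,\dots,s_r)$ converges, every $u_m$ lies in $\mathbb{D}_{\mathfrak{s}}$, and $$\zeta_A(s_1,\dots,s_r)=\frac{1}{\Gamma_{s_1}\cdots\Gamma_{s_r}}\sum_m a_m\,\mathrm{Li}_{\mathfrak{s}}(u_m).$$ In particular, $\zeta_A(s_1,\dots,s_r)$ is a $k$-linear combination of values of $\mathrm{Li}_{\mathfrak{s}}$ at points of $A^r\cap\mathbb{D}_{\mathfrak{s}}$. -/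

import Mathlib

open Polynomial

noncomputable section

namespace CarlitzMPL

/-! ### The fields `k = F(θ)`, `k_∞`, its algebraic closure, and `ℂ_∞`

Throughout `F` is a finite field with `q` elements, `A = F[X]` and `k = RatFunc F`; the variable
`X` plays the role of `θ`. -/

lemma one_lt_card_nnreal (F : Type*) [Field F] [Fintype F] :
    (1 : NNReal) < (Fintype.card F : NNReal) := by
  exact_mod_cast Fintype.one_lt_card (α := F)

section Fields

variable (F : Type*) [Field F] [Fintype F] [DecidableEq (RatFunc F)]

/-- `k_∞ = F((1/θ))`, the completion of `k` at the infinite place. -/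
abbrev KInfty : Type _ := RatFunc.CompletionAtInfty F

/-- The valuation at infinity has rank one; it is normalised so that `|θ|_∞ = q`. -/
instance rankOneInfty :
    Valuation.RankOne (Valued.v : Valuation (KInfty F) (WithZero (Multiplicative ℤ))) where
  hom' := (WithZeroMulInt.toNNReal (one_lt_card_nnreal F).ne_zero).comp
    MonoidWithZeroHom.ValueGroup₀.embedding
  strictMono' := (WithZeroMulInt.toNNReal_strictMono (one_lt_card_nnreal F)).comp
    MonoidWithZeroHom.ValueGroup₀.embedding_strictMono
  exists_val_nontrivial := by
    let _ : Valued (RatFunc F) (WithZero (Multiplicative ℤ)) := RatFunc.inftyValued F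
    refine ⟨((RatFunc.X : RatFunc F) : UniformSpace.Completion (RatFunc F)), ?_⟩
    have h : (Valued.v : Valuation (KInfty F) (WithZero (Multiplicative ℤ)))
        ((RatFunc.X : RatFunc F) : UniformSpace.Completion (RatFunc F)) = WithZero.exp 1 := by
      refine (Valued.extensionValuation_apply_coe (RatFunc.X : RatFunc F)).trans ?_
      exact RatFunc.inftyValuation.X F
    rw [h]
    exact ⟨by simp, by simp [← WithZero.exp_zero]⟩

/-- The absolute value `|·|_∞` on `k_∞`, inducing the given topology. -/
instance : NontriviallyNormedField (KInfty F) :=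
  Valued.toNontriviallyNormedField (KInfty F) (WithZero (Multiplicative ℤ))

instance : IsUltrametricDist (KInfty F) :=
  Valued.instIsUltrametricDist (KInfty F) (WithZero (Multiplicative ℤ))

instance : CompleteSpace (KInfty F) := by
  let _ : Valued (RatFunc F) (WithZero (Multiplicative ℤ)) := RatFunc.inftyValued F
  exact UniformSpace.Completion.completeSpace (RatFunc F)

/-- A fixed algebraic closure of `k_∞`. -/
abbrev KInftyBar : Type _ := AlgebraicClosure (KInfty F)

/-- The unique extension of `|·|_∞` to the algebraic closure of `k_∞`. -/
instance : NormedField (KInftyBar F) := spectralNorm.normedField (KInfty F) (KInftyBar F)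

/-- `ℂ_∞`, the completion of the algebraic closure of `k_∞`, with the extended absolute value. -/
abbrev CInfty : Type _ := UniformSpace.Completion (KInftyBar F)

/-- The embedding of `k_∞` in `ℂ_∞`. -/
def embInfty : KInfty F →+* CInfty F :=
  (algebraMap (KInftyBar F) (CInfty F)).comp (algebraMap (KInfty F) (KInftyBar F))

/-- The embedding of `k` in `ℂ_∞`. -/
def embK : RatFunc F →+* CInfty F :=
  (embInfty F).comp (algebraMap (RatFunc F) (KInfty F))

/-- The embedding of `A` in `ℂ_∞`. -/
def embA : F[X] →+* CInfty F :=
  (embK F).comp (algebraMap F[X] (RatFunc F))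

/-- `θ` as an element of `ℂ_∞`. -/
def theta : CInfty F := embA F X

/-- `ℂ_∞` as a vector space over `k`. -/
instance : Algebra (RatFunc F) (CInfty F) := (embK F).toAlgebra

end Fields

variable {F : Type*} [Field F] [Fintype F] [DecidableEq (RatFunc F)]

/-! ### Multizeta values -/

/-- `S_d(s) = ∑ 1/a^s ∈ k`, over the (finitely many) monic `a ∈ A` of degree `d`. -/
def powerSum (F : Type*) [Field F] (d s : ℕ) : RatFunc F :=
  ∑ᶠ a ∈ {a : F[X] | a.Monic ∧ a.natDegree = d}, 1 / (algebraMap F[X] (RatFunc F) a) ^ s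

/-- The `r`-tuples of monic polynomials with strictly decreasing degrees. -/
abbrev MonicTuple (F : Type*) [Field F] (r : ℕ) : Type _ :=
  {a : Fin r → F[X] // (∀ j, (a j).Monic) ∧ StrictAnti fun j => (a j).natDegree}

/-- The term `1 / (a_1^{s_1} ⋯ a_r^{s_r})` of the multizeta series, in `k_∞`. -/
def mzvTerm {r : ℕ} (s : Fin r → ℕ) (a : MonicTuple F r) : KInfty F :=
  algebraMap (RatFunc F) (KInfty F) (1 / ∏ j, (algebraMap F[X] (RatFunc F) (a.1 j)) ^ s j)

/-- The multizeta value `ζ_A(s_1, …, s_r) ∈ k_∞`. -/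
def mzv (F : Type*) [Field F] [Fintype F] [DecidableEq (RatFunc F)] {r : ℕ}
    (s : Fin r → ℕ) : KInfty F :=
  ∑' a : MonicTuple F r, mzvTerm s a

/-! ### Carlitz multiple polylogarithms -/

/-- `𝓛_i = ∏_{j=1}^{i} (θ - θ^{q^j}) ∈ A`. -/
def carlitzL (F : Type*) [Field F] [Fintype F] (i : ℕ) : F[X] :=
  ∏ j ∈ Finset.Icc 1 i, (X - X ^ Fintype.card F ^ j)

/-- The general term of `Li_𝔰(z_1, …, z_r)`, for indices `i_1 > ⋯ > i_r ≥ 0`. -/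
def cmplTerm {r : ℕ} (s : Fin r → ℕ) (z : Fin r → CInfty F)
    (i : {i : Fin r → ℕ // StrictAnti i}) : CInfty F :=
  (∏ j, z j ^ Fintype.card F ^ i.1 j) / ∏ j, embA F (carlitzL F (i.1 j)) ^ s j

/-- The convergence domain `𝔻_𝔰 ⊆ ℂ_∞^r` of `Li_𝔰`. -/
def cmplDomain (F : Type*) [Field F] [Fintype F] [DecidableEq (RatFunc F)] {r : ℕ}
    (s : Fin r → ℕ) : Set (Fin r → CInfty F) :=
  {z | Summable (cmplTerm s z)}

/-- The Carlitz multiple polylogarithm `Li_𝔰(z_1, …, z_r)`, meaningful on `cmplDomain F s`. -/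
def cmpl {r : ℕ} (s : Fin r → ℕ) (z : Fin r → CInfty F) : CInfty F :=
  ∑' i : {i : Fin r → ℕ // StrictAnti i}, cmplTerm s z i

/-! ### Carlitz factorials -/

/-- `D_n = ∏_{i=0}^{n-1} (θ^{q^n} - θ^{q^i}) ∈ A`. -/
def carlitzD (F : Type*) [Field F] [Fintype F] (n : ℕ) : F[X] :=
  ∏ i ∈ Finset.range n, (X ^ Fintype.card F ^ n - X ^ Fintype.card F ^ i)

/-- `Γ_s ∈ A` for `s ≥ 1`: if `s - 1 = ∑ n_i q^i` is the base `q` expansion, `Γ_s = ∏ D_i^{n_i}`.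
The digit `n_i` is `(s - 1) / q^i % q`, which vanishes for `i ≥ s`. -/
def carlitzGamma (F : Type*) [Field F] [Fintype F] (s : ℕ) : F[X] :=
  ∏ i ∈ Finset.range s, carlitzD F i ^ ((s - 1) / Fintype.card F ^ i % Fintype.card F)

/-! ### The function `Ω` and the Anderson–Thakur polynomials -/

open scoped PowerSeries.WithPiTopology in
/-- `Ω(t) = θ̃^{-q} ∏_{i ≥ 1} (1 - t / θ^{q^i})` as a power series in `t` over `ℂ_∞`; the product
converges coefficientwise. Here `θ̃` is a `(q-1)`-th root of `-θ`. -/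
def omega (θt : CInfty F) : PowerSeries (CInfty F) :=
  PowerSeries.C (θt ^ Fintype.card F)⁻¹ *
    ∏' i : ℕ, (1 - PowerSeries.C (theta F ^ Fintype.card F ^ (i + 1))⁻¹ * PowerSeries.X)

/-- The `d`-fold twist `f ↦ f^{(d)}` of a power series: `∑ a_i t^i ↦ ∑ a_i^{q^d} t^i`. -/
def twist (d : ℕ) (f : PowerSeries (CInfty F)) : PowerSeries (CInfty F) :=
  PowerSeries.mk fun i => PowerSeries.coeff i f ^ Fintype.card F ^ d

/-- The power series `f` converges at `t = θ`, with value `y`. -/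
def HasValueAtTheta (f : PowerSeries (CInfty F)) (y : CInfty F) : Prop :=
  HasSum (fun i : ℕ => PowerSeries.coeff i f * theta F ^ i) y

/-- `π̃ = 1 / Ω(θ)`. -/
def piTilde (θt : CInfty F) : CInfty F :=
  1 / ∑' i : ℕ, PowerSeries.coeff i (omega θt) * theta F ^ i

/-- A polynomial in `A[t]` as a power series in `t` over `ℂ_∞`. -/
def toSeries (P : F[X][X]) : PowerSeries (CInfty F) :=
  ((P.map (embA F) : (CInfty F)[X]) : PowerSeries (CInfty F))

/-- `(H_n)_{n ≥ 0}` is the sequence of Anderson–Thakur polynomials in `A[t]`: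
`(H_{s-1} Ω^s)^{(d)}(θ) = Γ_s S_d(s) / π̃^s` for all `d ≥ 0` and `s ≥ 1`. -/
def IsAndersonThakur (θt : CInfty F) (H : ℕ → F[X][X]) : Prop :=
  ∀ d s : ℕ, 1 ≤ s →
    HasValueAtTheta (twist d (toSeries (H (s - 1)) * omega θt ^ s))
      (embA F (carlitzGamma F s) * embK F (powerSum F d s) / piTilde θt ^ s)

/-- The tuples `(m_1, …, m_r)` with `m_j ≤ deg_t H_{s_j - 1}`; they index the families of
coefficients `u = (u_1, …, u_r)`, with `u_j` the coefficient of `t^{m_j}` in `H_{s_j - 1}`. -/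
def coeffIndex (H : ℕ → F[X][X]) {r : ℕ} (s : Fin r → ℕ) : Finset (Fin r → ℕ) :=
  Fintype.piFinset fun j => Finset.range ((H (s j - 1)).natDegree + 1)

/-- The integral point `u ∈ A^r` indexed by `m`: `u_j` is the coefficient of `t^{m_j}` in
`H_{s_j - 1}`. -/
def coeffPoint (H : ℕ → F[X][X]) {r : ℕ} (s m : Fin r → ℕ) : Fin r → F[X] :=
  fun j => (H (s j - 1)).coeff (m j)

end CarlitzMPL

end

/-! Everything rests on the identity H_n^{(d)}(θ) = Γ_{n+1} 𝓛_d^{n+1} S_d(n+1) in k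
(`twistEval_atPoly`). The Carlitz polynomial E_d is F-linear, kills polynomials of degree < d and is
1 on monic ones of degree d, so 1 - E_d(z) = ∏ (1 - z/a) over monic a of degree d
(`one_sub_carlitzE`). Since E_d' = 1/𝓛_d is constant, the logarithmic derivative gives a recursion
for S_d(n+1) (`powerSum_succ`). The polynomials `atPoly` satisfy one recursion in A[t], independent
of d, which P ↦ P^{(d)}(θ) carries to the recursion for S_d; its coefficients are integral by a
Legendre-type formula for Γ.

On the analytic side, Ω = Ω^{(d)} ∏_{i=1}^d (t - θ^{q^i}), hence Ω^{(d)}(θ) = 1/(π̃ 𝓛_d), and the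
defining property of the H_n becomes the identity above. The values P^{(d)}(θ) for all d determine
P, so `atPoly` is the only Anderson–Thakur sequence (`isAndersonThakur_iff`); its degree in θ is
bounded along the recursion.

For the formula, group the multizeta series by degrees into products of S_{d_j}(s_j), write Γ_s
S_d(s) = ∑_m θ^m u_m^{q^d} / 𝓛_d^s with u_m the coefficients of H_{s-1}, and expand the product. The
degree bound makes (q - 1) times the degree of u_m^{q^d} / 𝓛_d^s at most sq - q^{d+1}, so the terms
tend to 0, which suffices for convergence over a complete ultrametric field. -/

noncomputable section

namespace CarlitzMPL

/-! ### Powers of the `q`-Frobenius -/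

section Frobenius

variable (F : Type*) [Field F] [Fintype F]

/-- The `n`-th power `x ↦ x ^ q ^ n` of the `q`-Frobenius of an `F`-algebra. -/
def frobPow (R : Type*) [CommRing R] [Algebra F R] (n : ℕ) : R →ₐ[F] R :=
  FiniteField.frobeniusAlgHom F R ^ n

variable {F} in
@[simp]
lemma frobPow_apply {R : Type*} [CommRing R] [Algebra F R] (n : ℕ) (x : R) :
    frobPow F R n x = x ^ Fintype.card F ^ n := by
  induction n with
  | zero => simp [frobPow]
  | succ n ih =>
    rw [frobPow] at ih ⊢
    rw [pow_succ', AlgHom.mul_apply, ih, FiniteField.coe_frobeniusAlgHom]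
    exact (pow_mul _ _ _).symm.trans (by rw [← pow_succ])

variable {R : Type*} [CommRing R] [Algebra F R]

lemma sub_pow_card_pow (n : ℕ) (x y : R) :
    (x - y) ^ Fintype.card F ^ n = x ^ Fintype.card F ^ n - y ^ Fintype.card F ^ n := by
  simpa using map_sub (frobPow F R n) x y

lemma sum_pow_card_pow {ι : Type*} (n : ℕ) (s : Finset ι) (f : ι → R) :
    (∑ i ∈ s, f i) ^ Fintype.card F ^ n = ∑ i ∈ s, f i ^ Fintype.card F ^ n := by
  have h := map_sum (frobPow F R n) f s
  simp only [frobPow_apply] at h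
  exact h

lemma sum_pow_card {ι : Type*} (s : Finset ι) (f : ι → R) :
    (∑ i ∈ s, f i) ^ Fintype.card F = ∑ i ∈ s, f i ^ Fintype.card F := by
  simpa using sum_pow_card_pow F 1 s f

lemma card_pos' : 0 < Fintype.card F := Fintype.card_pos

end Frobenius

/-! ### The polynomials `[l]`, `D_n`, `𝓛_n` and `Γ_n` -/

section Gamma

variable (F : Type*) [Field F] [Fintype F]

/-- `[l] = θ^{q^l} - θ`. -/
def bracket (l : ℕ) : F[X] := X ^ Fintype.card F ^ l - X

lemma bracket_zero : bracket F 0 = 0 := by simp [bracket]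

lemma X_pow_sub_X_pow_ne_zero (F : Type*) [Field F] {a b : ℕ} (h : a ≠ b) :
    (X ^ a - X ^ b : F[X]) ≠ 0 := fun h0 =>
  h (by simpa using congrArg natDegree (sub_eq_zero.mp h0))

lemma card_pow_injective : Function.Injective fun n => Fintype.card F ^ n :=
  Nat.pow_right_injective Fintype.one_lt_card

lemma bracket_succ_ne_zero (l : ℕ) : bracket F (l + 1) ≠ 0 := by
  have := X_pow_sub_X_pow_ne_zero F (a := Fintype.card F ^ (l + 1)) (b := 1)
    (by simpa using (card_pow_injective F).ne (a₁ := l + 1) (a₂ := 0) (by simp))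
  simpa [bracket] using this

lemma carlitzD_ne_zero (n : ℕ) : carlitzD F n ≠ 0 :=
  Finset.prod_ne_zero_iff.mpr fun _ hi =>
    X_pow_sub_X_pow_ne_zero F ((card_pow_injective F).ne (Finset.mem_range.mp hi).ne')

lemma carlitzD_zero : carlitzD F 0 = 1 := by simp [carlitzD]

lemma carlitzD_succ (n : ℕ) :
    carlitzD F (n + 1) = bracket F (n + 1) * carlitzD F n ^ Fintype.card F := by
  rw [carlitzD, Finset.prod_range_succ', mul_comm, carlitzD, ← Finset.prod_pow]
  congr 1
  · simp [bracket]
  · refine Finset.prod_congr rfl fun i _ => ?_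
    have := sub_pow_card_pow F 1 (X ^ Fintype.card F ^ n : F[X]) (X ^ Fintype.card F ^ i)
    rw [pow_one] at this
    rw [this, ← pow_mul, ← pow_mul, ← pow_succ, ← pow_succ]

lemma carlitzL_eq_prod_range (n : ℕ) :
    carlitzL F n = ∏ j ∈ Finset.range n, (X - X ^ Fintype.card F ^ (j + 1)) := by
  rw [carlitzL, Finset.range_eq_Ico,
    Finset.prod_Ico_add' (fun j => (X - X ^ Fintype.card F ^ j : F[X])) 0 n 1]
  rfl

lemma carlitzL_zero : carlitzL F 0 = 1 := by simp [carlitzL]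

lemma carlitzL_succ (n : ℕ) :
    carlitzL F (n + 1) = carlitzL F n * (X - X ^ Fintype.card F ^ (n + 1)) := by
  rw [carlitzL_eq_prod_range, Finset.prod_range_succ, ← carlitzL_eq_prod_range]

lemma carlitzL_ne_zero (n : ℕ) : carlitzL F n ≠ 0 := by
  rw [carlitzL_eq_prod_range]
  refine Finset.prod_ne_zero_iff.mpr fun i _ => ?_
  rw [← neg_sub]
  exact neg_ne_zero.mpr (bracket_succ_ne_zero F i)

/-- Iterating D_{n+1} = [n+1] D_n^q gives the exponents q^{n-l}. Written as floors q^n / q^l they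
vanish for l > n, so the range may be any N ≥ n and products for different n can be compared factor
by factor. -/
lemma carlitzD_eq_prod_bracket {n N : ℕ} (h : n ≤ N) : carlitzD F n =
    ∏ l ∈ Finset.range N, bracket F (l + 1) ^ (Fintype.card F ^ n / Fintype.card F ^ (l + 1)) := by
  have hq := card_pos' F
  have h1 : carlitzD F n =
      ∏ l ∈ Finset.range n, bracket F (l + 1) ^ (Fintype.card F ^ n / Fintype.card F ^ (l + 1)) := by
    clear h
    induction n with
    | zero => simp [carlitzD_zero]
    | succ n ih =>
      rw [carlitzD_succ, Finset.prod_range_succ, ih, ← Finset.prod_pow, mul_comm,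
        Nat.div_self (by positivity), pow_one]
      congr 1
      refine Finset.prod_congr rfl fun l hl => ?_
      have hl' : l + 1 ≤ n := Finset.mem_range.mp hl
      rw [← pow_mul, Nat.pow_div hl' hq, Nat.pow_div (by lia) hq, ← pow_succ]
      congr 2
      lia
  rw [h1]
  refine Finset.prod_subset (Finset.range_mono h) fun l _ hl => ?_
  have hl' : n < l + 1 := by simpa [Nat.lt_succ_iff] using hl
  rw [Nat.div_eq_of_lt (Nat.pow_lt_pow_right Fintype.one_lt_card hl'), pow_zero]

/-- The digits below position k contribute 0 and the others sum exactly, as in Legendre's formula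
for the valuation of n!. -/
lemma sum_pow_div_mul_digit (b n k M : ℕ) (hb : 0 < b) :
    ∑ i ∈ Finset.range M, b ^ i / b ^ k * (n / b ^ i % b) = n % b ^ M / b ^ k := by
  induction M with
  | zero => simp [Nat.mod_one]
  | succ M ih =>
    rw [Finset.sum_range_succ, ih]
    rcases le_or_gt k M with h | h
    · rw [Nat.mod_pow_succ, ← Nat.add_sub_of_le h, pow_add, mul_assoc,
        Nat.add_mul_div_left _ _ (by positivity), Nat.mul_div_cancel_left _ (by positivity)]
    · have hM : b ^ (M + 1) ≤ b ^ k := Nat.pow_le_pow_right hb h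
      rw [Nat.div_eq_of_lt (lt_of_lt_of_le (Nat.mod_lt n (by positivity)) hM)]
      rcases Nat.lt_or_ge 1 b with h1 | h1
      · rw [Nat.div_eq_of_lt (Nat.pow_lt_pow_right h1 h), zero_mul, add_zero]
        exact Nat.div_eq_of_lt (lt_of_lt_of_le (Nat.mod_lt n (by positivity))
          (Nat.pow_le_pow_right hb h.le))
      · obtain rfl : b = 1 := by lia
        simp [Nat.mod_one]

lemma carlitzGamma_succ_eq_prod_bracket {n N : ℕ} (h : n ≤ N) : carlitzGamma F (n + 1) =
    ∏ l ∈ Finset.range N, bracket F (l + 1) ^ (n / Fintype.card F ^ (l + 1)) := by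
  have h1 : ∀ i ∈ Finset.range (n + 1),
      carlitzD F i ^ ((n + 1 - 1) / Fintype.card F ^ i % Fintype.card F) =
      ∏ l ∈ Finset.range N, bracket F (l + 1) ^ (Fintype.card F ^ i / Fintype.card F ^ (l + 1) *
        (n / Fintype.card F ^ i % Fintype.card F)) := by
    intro i hi
    rw [carlitzD_eq_prod_bracket F (N := N) (by simp at hi; lia), ← Finset.prod_pow]
    simp [← pow_mul]
  rw [carlitzGamma, Finset.prod_congr rfl h1, Finset.prod_comm]
  refine Finset.prod_congr rfl fun l _ => ?_
  rw [Finset.prod_pow_eq_pow_sum, sum_pow_div_mul_digit _ _ _ _ (card_pos' F), Nat.mod_eq_of_lt]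
  exact (Nat.lt_pow_self Fintype.one_lt_card).trans
    (Nat.pow_lt_pow_right Fintype.one_lt_card (Nat.lt_succ_self n))

lemma carlitzGamma_ne_zero (s : ℕ) : carlitzGamma F s ≠ 0 :=
  Finset.prod_ne_zero_iff.mpr fun _ _ => pow_ne_zero _ (carlitzD_ne_zero F _)

/-- With the exponent of [l] in Γ_{n+1} equal to ⌊n/q^l⌋, this is superadditivity of the floor: ⌊x⌋
+ ⌊y⌋ ≤ ⌊x + y⌋. It makes the coefficients of the Anderson–Thakur recursion integral. -/
lemma carlitzD_mul_carlitzGamma_dvd {n i : ℕ} (h : Fintype.card F ^ i ≤ n) :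
    carlitzD F i * carlitzGamma F (n - Fintype.card F ^ i + 1) ∣ carlitzGamma F (n + 1) := by
  have hi : i ≤ n := (Nat.lt_pow_self Fintype.one_lt_card).le.trans h
  rw [carlitzD_eq_prod_bracket F hi, carlitzGamma_succ_eq_prod_bracket F (le_refl n),
    carlitzGamma_succ_eq_prod_bracket F (Nat.sub_le n (Fintype.card F ^ i)),
    ← Finset.prod_mul_distrib]
  refine Finset.prod_dvd_prod_of_dvd _ _ fun l _ => ?_
  rw [← pow_add]
  refine pow_dvd_pow _ (Nat.div_add_div_le_add_div.trans ?_)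
  rw [Nat.add_sub_of_le h]

end Gamma

/-! ### The Carlitz polynomials and power sums -/

section CarlitzE

lemma algebraMap_ne_zero_of_ne_zero (F : Type*) [Field F] {a : F[X]} (h : a ≠ 0) :
    algebraMap F[X] (RatFunc F) a ≠ 0 :=
  (map_ne_zero_iff _ (RatFunc.algebraMap_injective F)).mpr h

variable (F : Type*) [Field F] [Fintype F]

local notation "ι" => algebraMap F[X] (RatFunc F)

/-- The coefficient `1 / (D_i 𝓛_{d-i}^{q^i})` of `z^{q^i}` in the Carlitz polynomial. -/
def carlitzECoeff (d i : ℕ) : RatFunc F :=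
  (ι (carlitzD F i * carlitzL F (d - i) ^ Fintype.card F ^ i))⁻¹

/-- The normalised Carlitz polynomial `E_d(z) = ∑_{i ≤ d} z^{q^i} / (D_i 𝓛_{d-i}^{q^i})`. -/
def carlitzE (d : ℕ) : (RatFunc F)[X] :=
  ∑ i ∈ Finset.range (d + 1), C (carlitzECoeff F d i) * X ^ Fintype.card F ^ i

/-- The `F`-linear map `z ↦ E_d(z)`. -/
def carlitzELin (d : ℕ) : RatFunc F →ₗ[F] RatFunc F :=
  ∑ i ∈ Finset.range (d + 1),
    (LinearMap.mulLeft F (carlitzECoeff F d i)).comp (frobPow F (RatFunc F) i).toLinearMap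

lemma carlitzELin_apply (d : ℕ) (x : RatFunc F) : carlitzELin F d x =
    ∑ i ∈ Finset.range (d + 1), carlitzECoeff F d i * x ^ Fintype.card F ^ i := by
  simp [carlitzELin]

/-- Joins the two forms of E_d: the polynomial serves for counting roots and differentiating, the
linear map for computing values. -/
lemma eval_carlitzE (d : ℕ) (x : RatFunc F) : (carlitzE F d).eval x = carlitzELin F d x := by
  simp [carlitzE, carlitzELin_apply, eval_finsetSum]

lemma bracket_mul_carlitzECoeff (d i : ℕ) :
    ι (bracket F (i + 1)) * carlitzECoeff F (d + 1) (i + 1) =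
      carlitzECoeff F d i ^ Fintype.card F := by
  have h0 := algebraMap_ne_zero_of_ne_zero F (bracket_succ_ne_zero F i)
  rw [carlitzECoeff, carlitzECoeff, Nat.add_sub_add_right, carlitzD_succ, inv_pow, ← map_pow,
    mul_pow, ← pow_mul, ← pow_succ, mul_assoc, map_mul, mul_inv, ← mul_assoc,
    mul_inv_cancel₀ h0, one_mul]

/-- The difference [i] - [d+1] is (θ - θ^{q^{d+1-i}})^{q^i}, precisely the extra factor of
𝓛_{d+1-i}^{q^i} over 𝓛_{d-i}^{q^i}. -/
lemma sub_mul_carlitzECoeff {d i : ℕ} (h : i ≤ d) :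
    ι (bracket F i - bracket F (d + 1)) * carlitzECoeff F (d + 1) i = carlitzECoeff F d i := by
  have h1 : bracket F i - bracket F (d + 1) =
      (X - X ^ Fintype.card F ^ (d - i + 1)) ^ Fintype.card F ^ i := by
    rw [sub_pow_card_pow, ← pow_mul, ← pow_add, show d - i + 1 + i = d + 1 by lia]
    simp [bracket]
  have h2 : (X - X ^ Fintype.card F ^ (d - i + 1) : F[X]) ≠ 0 := by
    rw [← neg_sub]
    exact neg_ne_zero.mpr (bracket_succ_ne_zero F _)
  have h3 := algebraMap_ne_zero_of_ne_zero F (pow_ne_zero (Fintype.card F ^ i) h2)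
  rw [carlitzECoeff, carlitzECoeff, Nat.sub_add_comm h, carlitzL_succ, h1, mul_pow, ← mul_assoc,
    map_mul _ (_ * _), mul_inv, mul_comm, mul_assoc, inv_mul_cancel₀ h3, mul_one]

/-- Raising to the q-th power shifts the index by one; the added term i = 0 vanishes because [0] =
0. This puts E_d^q and E_{d+1} over the same coefficients. -/
lemma carlitzELin_pow_card (d : ℕ) (x : RatFunc F) : carlitzELin F d x ^ Fintype.card F =
    ∑ i ∈ Finset.range (d + 2),
      ι (bracket F i) * carlitzECoeff F (d + 1) i * x ^ Fintype.card F ^ i := by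
  rw [carlitzELin_apply, sum_pow_card, Finset.sum_range_succ' _ (d + 1), bracket_zero, map_zero,
    zero_mul, zero_mul, add_zero]
  refine Finset.sum_congr rfl fun i _ => ?_
  rw [bracket_mul_carlitzECoeff, mul_pow, ← pow_mul, ← pow_succ]

lemma carlitzELin_X_mul (d : ℕ) (x : RatFunc F) : carlitzELin F (d + 1) (ι X * x) =
    ι X * carlitzELin F (d + 1) x + carlitzELin F d x ^ Fintype.card F := by
  rw [carlitzELin_pow_card, carlitzELin_apply, carlitzELin_apply, Finset.mul_sum,
    ← Finset.sum_add_distrib]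
  refine Finset.sum_congr rfl fun i _ => ?_
  rw [bracket, map_sub, map_pow, mul_pow]
  ring

lemma bracket_mul_carlitzELin (d : ℕ) (x : RatFunc F) :
    ι (bracket F (d + 1)) * carlitzELin F (d + 1) x =
    carlitzELin F d x ^ Fintype.card F - carlitzELin F d x := by
  rw [carlitzELin_pow_card, Finset.sum_range_succ, carlitzELin_apply F (d + 1),
    Finset.sum_range_succ,
    carlitzELin_apply F d, add_sub_right_comm, ← Finset.sum_sub_distrib, mul_add, Finset.mul_sum,
    mul_assoc]
  congr 1
  refine Finset.sum_congr rfl fun i hi => ?_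
  rw [← sub_mul_carlitzECoeff F (Nat.lt_succ_iff.mp (Finset.mem_range.mp hi)), map_sub]
  ring

lemma carlitzELin_zero_apply (x : RatFunc F) : carlitzELin F 0 x = x := by
  simp [carlitzELin_apply, carlitzECoeff, carlitzD_zero, carlitzL_zero]

lemma carlitzELin_succ_one (d : ℕ) : carlitzELin F (d + 1) 1 = 0 := by
  have h0 := algebraMap_ne_zero_of_ne_zero F (bracket_succ_ne_zero F d)
  refine (mul_eq_zero.mp ?_).resolve_left h0
  rw [bracket_mul_carlitzELin]
  cases d with
  | zero => simp [carlitzELin_zero_apply]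
  | succ d => rw [carlitzELin_succ_one d, zero_pow Fintype.card_ne_zero, sub_zero]

/-- Double induction on E_{d+1}(θx) = θ E_{d+1}(x) + E_d(x)^q, started by E_{d+1}(1) = 0. By
linearity E_d then reads off the coefficient of θ^d of a polynomial of degree ≤ d. -/
lemma carlitzELin_X_pow {d j : ℕ} (h : j ≤ d) :
    carlitzELin F d (ι X ^ j) = if j = d then 1 else 0 := by
  induction d generalizing j with
  | zero => simp_all [carlitzELin_zero_apply]
  | succ d ihd =>
    induction j with
    | zero => simp [carlitzELin_succ_one]
    | succ j ihj =>
      rw [pow_succ', carlitzELin_X_mul, ihj (by lia), ihd (by lia)]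
      rw [if_neg (by lia)]
      by_cases hj : j = d <;> simp [hj, Fintype.card_ne_zero]

lemma carlitzELin_C_mul (d : ℕ) (c : F) (x : RatFunc F) :
    carlitzELin F d (ι (C c) * x) = ι (C c) * carlitzELin F d x := by
  have h : ι (C c) = algebraMap F (RatFunc F) c :=
    (IsScalarTower.algebraMap_apply F F[X] (RatFunc F) c).symm
  rw [h, ← Algebra.smul_def, ← Algebra.smul_def, map_smul]

lemma carlitzELin_algebraMap {d : ℕ} {a : F[X]} (h : a.natDegree ≤ d) :
    carlitzELin F d (ι a) = ι (C (a.coeff d)) := by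
  conv_lhs => rw [a.as_sum_range_C_mul_X_pow' (Nat.lt_succ_of_le h)]
  rw [map_sum, map_sum, Finset.sum_eq_single d]
  · rw [map_mul, carlitzELin_C_mul, map_pow, carlitzELin_X_pow F le_rfl, if_pos rfl, mul_one]
  · intro j hj hjd
    rw [map_mul, carlitzELin_C_mul, map_pow, carlitzELin_X_pow F (by simp at hj; lia), if_neg hjd,
      mul_zero]
  · simp

/-- In characteristic p only the term with exponent q^0 survives differentiation. -/
lemma derivative_carlitzE (d : ℕ) : derivative (carlitzE F d) = C (ι (carlitzL F d))⁻¹ := by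
  have hq : ((Fintype.card F : ℕ) : RatFunc F) = 0 := by
    rw [← map_natCast (algebraMap F (RatFunc F)), FiniteField.cast_card_eq_zero, map_zero]
  rw [carlitzE, derivative_sum, Finset.sum_range_succ']
  simp [derivative_X_pow, hq, carlitzECoeff, carlitzD_zero]

lemma natDegree_carlitzE_le (d : ℕ) : (carlitzE F d).natDegree ≤ Fintype.card F ^ d := by
  refine natDegree_sum_le_of_forall_le _ _ fun i hi => ?_
  refine (natDegree_C_mul_X_pow_le _ _).trans (Nat.pow_le_pow_right (card_pos' F) ?_)
  simpa [Nat.lt_succ_iff] using hi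

end CarlitzE

/-! ### Monic polynomials of a given degree and power sums -/

section PowerSum

variable (F : Type*) [Field F] [Fintype F]

local notation "ι" => algebraMap F[X] (RatFunc F)

/-- The monic polynomials of degree `d` correspond to the vectors of their lower coefficients. -/
def monicEquivFun (d : ℕ) : {a : F[X] | a.Monic ∧ a.natDegree = d} ≃ (Fin d → F) :=
  (monicEquivDegreeLT d).trans (degreeLTEquiv F d).toEquiv

lemma finite_monic_natDegree_eq (d : ℕ) : {a : F[X] | a.Monic ∧ a.natDegree = d}.Finite :=
  have := Finite.of_equiv _ (monicEquivFun F d).symm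
  Set.toFinite _

/-- The finite set of monic polynomials of degree `d`. -/
def monicsOfDegree (d : ℕ) : Finset F[X] := (finite_monic_natDegree_eq F d).toFinset

variable {F} in
@[simp]
lemma mem_monicsOfDegree {d : ℕ} {a : F[X]} :
    a ∈ monicsOfDegree F d ↔ a.Monic ∧ a.natDegree = d := by
  simp [monicsOfDegree]

lemma card_monicsOfDegree (d : ℕ) : (monicsOfDegree F d).card = Fintype.card F ^ d := by
  rw [monicsOfDegree, ← Set.ncard_eq_toFinset_card _ (finite_monic_natDegree_eq F d),
    ← Nat.card_coe_set_eq,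
    Nat.card_congr (monicEquivFun F d)]
  simp

lemma powerSum_eq_sum (d s : ℕ) : powerSum F d s = ∑ a ∈ monicsOfDegree F d, 1 / ι a ^ s :=
  finsum_mem_eq_finite_toFinset_sum _ _

variable {F} in
lemma algebraMap_ne_zero_of_mem {d : ℕ} {a : F[X]} (h : a ∈ monicsOfDegree F d) : ι a ≠ 0 :=
  algebraMap_ne_zero_of_ne_zero F (mem_monicsOfDegree.mp h).1.ne_zero

/-- Both sides have degree ≤ q^d and agree at q^d + 1 points: both are 1 at 0, and both vanish at
the q^d monic polynomials of degree d. -/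
lemma one_sub_carlitzE (d : ℕ) :
    1 - carlitzE F d = ∏ a ∈ monicsOfDegree F d, (1 - C (ι a)⁻¹ * X) := by
  classical
  have hinj := RatFunc.algebraMap_injective F
  set S : Finset (RatFunc F) := insert 0 ((monicsOfDegree F d).map ⟨ι, hinj⟩) with hS
  have hcard : S.card = Fintype.card F ^ d + 1 := by
    rw [hS, Finset.card_insert_of_notMem, Finset.card_map, card_monicsOfDegree]
    simp only [Finset.mem_map, Function.Embedding.coeFn_mk, not_exists, not_and]
    exact fun a ha => algebraMap_ne_zero_of_mem ha
  refine eq_of_degrees_lt_of_eval_finset_eq S ?_ ?_ ?_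
  · rw [hcard]
    refine degree_le_natDegree.trans_lt (Nat.cast_lt.mpr (Nat.lt_succ_of_le ?_))
    exact (natDegree_sub_le _ _).trans (max_le (by simp) (natDegree_carlitzE_le F d))
  · rw [hcard]
    refine degree_le_natDegree.trans_lt (Nat.cast_lt.mpr (Nat.lt_succ_of_le ?_))
    refine (natDegree_prod_le _ _).trans ?_
    rw [← card_monicsOfDegree, Finset.card_eq_sum_ones]
    refine Finset.sum_le_sum fun a _ => (natDegree_sub_le _ _).trans (max_le (by simp) ?_)
    exact natDegree_C_mul_le _ _ |>.trans natDegree_X_le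
  · intro x hx
    rw [eval_sub, eval_one, eval_carlitzE, eval_prod]
    rcases Finset.mem_insert.mp hx with rfl | hx
    · simp
    · obtain ⟨a, ha, rfl⟩ := Finset.mem_map.mp hx
      have ha' := mem_monicsOfDegree.mp ha
      rw [Finset.prod_eq_zero ha]
      · simp only [Function.Embedding.coeFn_mk]
        rw [carlitzELin_algebraMap F ha'.2.le, ← ha'.2, coeff_natDegree, ha'.1.leadingCoeff]
        simp
      · simp [algebraMap_ne_zero_of_mem ha]

/-- The generating series `∑_n S_d(n + 1) z^n` of the power sums. -/
def powerSumSeries (d : ℕ) : PowerSeries (RatFunc F) :=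
  PowerSeries.mk fun n => powerSum F d (n + 1)

/-- The logarithmic derivative of ∏ (1 - z/a) is -∑ a⁻¹/(1 - z/a), whose expansion is minus the
generating series of the power sums, while the derivative of 1 - E_d is the constant -1/𝓛_d. -/
lemma one_sub_carlitzE_mul_powerSumSeries (d : ℕ) :
    ((1 - carlitzE F d : (RatFunc F)[X]) : PowerSeries (RatFunc F)) * powerSumSeries F d =
      PowerSeries.C (ι (carlitzL F d))⁻¹ := by
  classical
  have hg : powerSumSeries F d = ∑ a ∈ monicsOfDegree F d,
      PowerSeries.C (ι a)⁻¹ * PowerSeries.mk fun n => (ι a)⁻¹ ^ n := by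
    ext n
    simp [powerSumSeries, powerSum_eq_sum, pow_succ', mul_comm]
  have h1 : ∀ a : F[X], ((1 - C (ι a)⁻¹ * X : (RatFunc F)[X]) : PowerSeries (RatFunc F)) *
      (PowerSeries.mk fun n => (ι a)⁻¹ ^ n) = 1 := by
    intro a
    ext n
    rw [Polynomial.coe_sub, Polynomial.coe_one, Polynomial.coe_mul, Polynomial.coe_C,
      Polynomial.coe_X, sub_mul, one_mul, mul_assoc, map_sub, PowerSeries.coeff_C_mul]
    cases n with
    | zero => simp
    | succ n =>
      rw [PowerSeries.coeff_succ_X_mul]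
      simp [pow_succ', PowerSeries.coeff_one, mul_comm]
  have h2 : ((derivative (1 - carlitzE F d) : (RatFunc F)[X]) : PowerSeries (RatFunc F)) =
      - PowerSeries.C (ι (carlitzL F d))⁻¹ := by
    rw [derivative_sub, derivative_one, zero_sub, derivative_carlitzE, Polynomial.coe_neg,
      Polynomial.coe_C]
  rw [← neg_eq_iff_eq_neg] at h2
  rw [← h2, one_sub_carlitzE, derivative_prod_finset, hg, Finset.mul_sum,
    ← Polynomial.coeToPowerSeries.ringHom_apply, ← Polynomial.coeToPowerSeries.ringHom_apply,
    map_sum, ← Finset.sum_neg_distrib]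
  refine Finset.sum_congr rfl fun a ha => ?_
  rw [← Finset.prod_erase_mul _ _ ha, map_mul, map_mul, mul_assoc,
    mul_left_comm _ (PowerSeries.C _),
    Polynomial.coeToPowerSeries.ringHom_apply (φ := 1 - C (ι a)⁻¹ * X), h1, mul_one]
  simp

lemma powerSum_succ (d n : ℕ) : powerSum F d (n + 1) =
    (if n = 0 then (ι (carlitzL F d))⁻¹ else 0) + ∑ i ∈ Finset.range (d + 1),
      if Fintype.card F ^ i ≤ n then
        carlitzECoeff F d i * powerSum F d (n - Fintype.card F ^ i + 1) else 0 := by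
  have h := congrArg (PowerSeries.coeff n) (one_sub_carlitzE_mul_powerSumSeries F d)
  rw [Polynomial.coe_sub, Polynomial.coe_one, sub_mul, one_mul, map_sub, PowerSeries.coeff_C,
    sub_eq_iff_eq_add, carlitzE, ← Polynomial.coeToPowerSeries.ringHom_apply, map_sum,
    Finset.sum_mul, map_sum] at h
  rw [powerSumSeries, PowerSeries.coeff_mk] at h
  rw [h]
  congr 1
  refine Finset.sum_congr rfl fun i _ => ?_
  rw [Polynomial.coeToPowerSeries.ringHom_apply, Polynomial.coe_mul, Polynomial.coe_C,
    Polynomial.coe_pow, Polynomial.coe_X, mul_assoc, PowerSeries.coeff_C_mul,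
    PowerSeries.coeff_X_pow_mul', PowerSeries.coeff_mk]
  split_ifs <;> simp

end PowerSum

/-! ### The Anderson–Thakur polynomials -/

section AndersonThakur

variable (F : Type*) [Field F] [Fintype F]

local notation "ι" => algebraMap F[X] (RatFunc F)

/-- `G_i = ∏_{j=1}^i (t^{q^i} - θ^{q^j}) ∈ A[t]`. -/
def atG (i : ℕ) : F[X][X] :=
  ∏ j ∈ Finset.range i, (X ^ Fintype.card F ^ i - C (X ^ Fintype.card F ^ (j + 1)))

/-- `Γ_{n+1} / (D_i Γ_{n-q^i+1})`, an element of `A` when `q^i ≤ n`. -/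
def gammaQuot (n i : ℕ) : F[X] :=
  carlitzGamma F (n + 1) / (carlitzD F i * carlitzGamma F (n - Fintype.card F ^ i + 1))

lemma mul_gammaQuot {n i : ℕ} (h : Fintype.card F ^ i ≤ n) :
    carlitzD F i * carlitzGamma F (n - Fintype.card F ^ i + 1) * gammaQuot F n i =
      carlitzGamma F (n + 1) :=
  EuclideanDomain.mul_div_cancel' (mul_ne_zero (carlitzD_ne_zero F i) (carlitzGamma_ne_zero F _))
    (carlitzD_mul_carlitzGamma_dvd F h)

/-- The Anderson–Thakur polynomials, determined by the recursion that expresses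
`∑_n H_n / Γ_{n+1}(t) x^n = (1 - ∑_i G_i / D_i(t) x^{q^i})⁻¹`. -/
def atPoly : ℕ → F[X][X]
  | 0 => 1
  -- The range i ≤ n loses nothing, since i < q^i ≤ n + 1. The index n - (q^i - 1) equals n + 1 -
  -- q^i but is visibly at most n, which gives termination without using the condition.
  | n + 1 => ∑ i ∈ Finset.range (n + 1), if Fintype.card F ^ i ≤ n + 1 then
      (gammaQuot F (n + 1) i).map C * atG F i * atPoly (n - (Fintype.card F ^ i - 1)) else 0
  decreasing_by exact Nat.lt_succ_of_le (Nat.sub_le _ _)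

lemma atPoly_zero : atPoly F 0 = 1 := by rw [atPoly]

lemma atPoly_succ (n : ℕ) : atPoly F (n + 1) =
    ∑ i ∈ Finset.range (n + 1), if Fintype.card F ^ i ≤ n + 1 then
      (gammaQuot F (n + 1) i).map C * atG F i * atPoly F (n + 1 - Fintype.card F ^ i) else 0 := by
  rw [atPoly]
  refine Finset.sum_congr rfl fun i _ => ?_
  have hpos : 0 < Fintype.card F ^ i := pow_pos (card_pos' F) i
  rw [show n - (Fintype.card F ^ i - 1) = n + 1 - Fintype.card F ^ i by lia]

/-! #### Degrees in `θ` -/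

/-- `(q - 1) deg_θ P ≤ k`. -/
def ThetaDegreeLE (k : ℕ) (P : F[X][X]) : Prop :=
  ∀ m, (P.coeff m).natDegree * (Fintype.card F - 1) ≤ k

variable {F}

lemma ThetaDegreeLE.mono {k l : ℕ} {P : F[X][X]} (h : ThetaDegreeLE F k P) (hkl : k ≤ l) :
    ThetaDegreeLE F l P := fun m => (h m).trans hkl

lemma natDegree_sum_mul_le {F : Type*} [Field F] {α : Type*} (s : Finset α) (f : α → F[X]) (c k : ℕ)
    (h : ∀ i ∈ s, (f i).natDegree * c ≤ k) : (∑ i ∈ s, f i).natDegree * c ≤ k := by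
  classical
  induction s using Finset.induction_on with
  | empty => simp
  | insert a s ha ih =>
    rw [Finset.sum_insert ha]
    refine (Nat.mul_le_mul_right c (natDegree_add_le _ _)).trans ?_
    rw [max_mul_of_nonneg _ _ (Nat.zero_le _)]
    exact max_le (h a (by simp)) (ih fun i hi => h i (by simp [hi]))

lemma ThetaDegreeLE.sum {α : Type*} {k : ℕ} {s : Finset α} {f : α → F[X][X]}
    (h : ∀ i ∈ s, ThetaDegreeLE F k (f i)) : ThetaDegreeLE F k (∑ i ∈ s, f i) := fun m => by
  rw [finsetSum_coeff]
  exact natDegree_sum_mul_le s _ _ _ fun i hi => h i hi m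

lemma ThetaDegreeLE.mul {k l : ℕ} {P Q : F[X][X]} (hP : ThetaDegreeLE F k P)
    (hQ : ThetaDegreeLE F l Q) : ThetaDegreeLE F (k + l) (P * Q) := fun m => by
  rw [coeff_mul]
  refine natDegree_sum_mul_le _ _ _ _ fun i _ => ?_
  refine (Nat.mul_le_mul_right _ natDegree_mul_le).trans ?_
  rw [add_mul]
  exact Nat.add_le_add (hP _) (hQ _)

/-- Here `b.map C` is b(t), with θ replaced by t, so its coefficients are constant in θ. -/
lemma thetaDegreeLE_map_C (k : ℕ) (b : F[X]) : ThetaDegreeLE F k (b.map C) := fun m => by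
  simp [coeff_map]

lemma thetaDegreeLE_X_pow_sub_C (n N : ℕ) :
    ThetaDegreeLE F (N * (Fintype.card F - 1)) (X ^ n - C (X ^ N)) := fun m => by
  refine Nat.mul_le_mul_right _ ?_
  rw [coeff_sub, coeff_X_pow, coeff_C]
  refine (natDegree_sub_le _ _).trans (max_le ?_ ?_)
  · split_ifs <;> simp
  · split_ifs <;> simp

lemma ThetaDegreeLE.prod {α : Type*} {k : α → ℕ} {s : Finset α} {f : α → F[X][X]}
    (h : ∀ i ∈ s, ThetaDegreeLE F (k i) (f i)) :
    ThetaDegreeLE F (∑ i ∈ s, k i) (∏ i ∈ s, f i) := by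
  classical
  induction s using Finset.induction_on with
  | empty => simpa using thetaDegreeLE_map_C (F := F) 0 1
  | insert a s ha ih =>
    rw [Finset.sum_insert ha, Finset.prod_insert ha]
    exact (h a (by simp)).mul (ih fun i hi => h i (by simp [hi]))

variable (F)

lemma thetaDegreeLE_atG (i : ℕ) :
    ThetaDegreeLE F (Fintype.card F ^ i * Fintype.card F) (atG F i) := by
  refine (ThetaDegreeLE.prod fun j _ => thetaDegreeLE_X_pow_sub_C _ _).mono ?_
  have hq : Fintype.card F - 1 + 1 = Fintype.card F := Nat.sub_add_cancel (card_pos' F)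
  -- Geometric sum: (q - 1)(q + ⋯ + q^i) = q^{i+1} - q. The spare q is discarded.
  have h (i : ℕ) : ∑ j ∈ Finset.range i, Fintype.card F ^ (j + 1) * (Fintype.card F - 1) +
      Fintype.card F = Fintype.card F ^ (i + 1) := by
    induction i with
    | zero => simp
    | succ i ih =>
      rw [Finset.sum_range_succ, add_right_comm, ih]
      rw [add_comm, ← Nat.mul_succ, Nat.succ_eq_add_one, hq, ← pow_succ]
  rw [← pow_succ, ← h i]
  exact Nat.le_add_right _ _

lemma thetaDegreeLE_atPoly (n : ℕ) : ThetaDegreeLE F (n * Fintype.card F) (atPoly F n) := by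
  induction n using Nat.strong_induction_on with
  | _ n ih =>
    cases n with
    | zero =>
      rw [atPoly_zero]
      simpa using thetaDegreeLE_map_C (F := F) 0 1
    | succ n =>
      rw [atPoly_succ]
      refine ThetaDegreeLE.sum fun i _ => ?_
      split_ifs with h
      · have hpos : 0 < Fintype.card F ^ i := pow_pos (card_pos' F) i
        refine (((thetaDegreeLE_map_C 0 _).mul (thetaDegreeLE_atG F i)).mul
          (ih (n + 1 - Fintype.card F ^ i) (by lia))).mono ?_
        rw [zero_add, ← add_mul, Nat.add_sub_of_le h]
      · simpa using thetaDegreeLE_map_C (F := F) _ 0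

/-! #### Values at `t = θ` of twists -/

/-- The specialisation `A[t] → A`, `θ ↦ θ^{q^d}`, `t ↦ θ`, that is, `P ↦ P^{(d)}(θ)`. -/
def twistEval (d : ℕ) : F[X][X] →+* F[X] :=
  eval₂RingHom (frobPow F F[X] d : F[X] →+* F[X]) X

lemma twistEval_apply (d : ℕ) (P : F[X][X]) : twistEval F d P =
    ∑ m ∈ Finset.range (P.natDegree + 1), P.coeff m ^ Fintype.card F ^ d * X ^ m := by
  simp [twistEval, eval₂_eq_sum_range]

lemma twistEval_X (d : ℕ) : twistEval F d X = X := by simp [twistEval]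

lemma twistEval_C (d : ℕ) (a : F[X]) : twistEval F d (C a) = a ^ Fintype.card F ^ d := by
  simp [twistEval]

/-- The coefficients of b(t) lie in F, hence are fixed by the Frobenius, and t goes back to θ. -/
lemma twistEval_map_C (d : ℕ) (b : F[X]) : twistEval F d (b.map C) = b := by
  have h : (frobPow F F[X] d : F[X] →+* F[X]).comp C = C :=
    RingHom.ext fun c => (frobPow F F[X] d).commutes c
  rw [twistEval, coe_eval₂RingHom, eval₂_map, h, eval₂_C_X]

lemma twistEval_atG (d i : ℕ) : twistEval F d (atG F i) = ∏ j ∈ Finset.range i,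
    (X ^ Fintype.card F ^ i - X ^ Fintype.card F ^ (j + 1 + d)) := by
  simp only [atG, map_prod, map_sub, map_pow (twistEval F d), twistEval_X, twistEval_C, ← pow_mul,
    ← pow_add]

lemma twistEval_atG_eq_zero {d i : ℕ} (h : d < i) : twistEval F d (atG F i) = 0 := by
  rw [twistEval_atG]
  refine Finset.prod_eq_zero (i := i - d - 1) (Finset.mem_range.mpr (by lia)) ?_
  rw [show i - d - 1 + 1 + d = i by lia, sub_self]

/-- The factor θ^{q^i} - θ^{q^{j+d}} is the q^i-th power of θ - θ^{q^{d-i+j}}, so the twisted G_i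
supplies exactly the last i factors of 𝓛_d. -/
lemma carlitzL_pow_mul_twistEval_atG {d i : ℕ} (h : i ≤ d) :
    carlitzL F (d - i) ^ Fintype.card F ^ i * twistEval F d (atG F i) =
      carlitzL F d ^ Fintype.card F ^ i := by
  obtain ⟨e, rfl⟩ := Nat.exists_eq_add_of_le' h
  rw [Nat.add_sub_cancel, twistEval_atG, carlitzL_eq_prod_range, carlitzL_eq_prod_range,
    Finset.prod_range_add, mul_pow]
  congr 1
  rw [← Finset.prod_pow]
  refine Finset.prod_congr rfl fun j _ => ?_
  rw [sub_pow_card_pow, ← pow_mul, ← pow_add]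
  congr 3
  lia

lemma twistEval_atPoly (d n : ℕ) : ι (twistEval F d (atPoly F n)) =
    ι (carlitzGamma F (n + 1)) * ι (carlitzL F d) ^ (n + 1) * powerSum F d (n + 1) := by
  have hL := algebraMap_ne_zero_of_ne_zero F (carlitzL_ne_zero F d)
  induction n using Nat.strong_induction_on with
  | _ n ih =>
    cases n with
    | zero =>
      rw [atPoly_zero, powerSum_succ, Finset.sum_eq_zero]
      · simp [carlitzGamma, hL]
      · intro i _
        rw [if_neg]
        simp
    | succ n =>
      have hS (M N : ℕ) (hMN : M ≤ N) (f : ℕ → RatFunc F) (h0 : ∀ i, M ≤ i → f i = 0) :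
          ∑ i ∈ Finset.range M, f i = ∑ i ∈ Finset.range N, f i :=
        Finset.sum_subset (Finset.range_mono hMN) fun i _ hi => h0 i (by simpa using hi)
      have hi (i : ℕ) (hi : n + 1 ≤ i) : ¬ Fintype.card F ^ i ≤ n + 1 := fun h =>
        absurd ((Nat.lt_pow_self Fintype.one_lt_card).trans_le h) (by lia)
      rw [atPoly_succ, powerSum_succ, if_neg n.succ_ne_zero, zero_add, map_sum, map_sum,
        Finset.mul_sum]
      -- The two recursions match term by term for i ≤ d; for i > d the twisted G_i vanishes. Their
      -- ranges i ≤ n and i ≤ d are later both enlarged by zero terms to a common one.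
      have key (i : ℕ) : ι (twistEval F d (if Fintype.card F ^ i ≤ n + 1 then
          (gammaQuot F (n + 1) i).map C * atG F i * atPoly F (n + 1 - Fintype.card F ^ i) else 0)) =
          if i ≤ d then ι (carlitzGamma F (n + 1 + 1)) * ι (carlitzL F d) ^ (n + 1 + 1) *
            (if Fintype.card F ^ i ≤ n + 1 then
              carlitzECoeff F d i * powerSum F d (n + 1 - Fintype.card F ^ i + 1) else 0)
            else 0 := by
        by_cases hn : Fintype.card F ^ i ≤ n + 1
        · rw [if_pos hn, if_pos hn, map_mul, map_mul, map_mul, map_mul, twistEval_map_C]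
          by_cases hd : i ≤ d
          · have hpos : 0 < Fintype.card F ^ i := pow_pos (card_pos' F) i
            have hD := algebraMap_ne_zero_of_ne_zero F (carlitzD_ne_zero F i)
            have hE := algebraMap_ne_zero_of_ne_zero F
              (pow_ne_zero (Fintype.card F ^ i) (carlitzL_ne_zero F (d - i)))
            have h1 := congrArg ι (carlitzL_pow_mul_twistEval_atG F hd)
            have h2 : ι (carlitzL F d) ^ (n + 1 + 1) = ι (carlitzL F d) ^ Fintype.card F ^ i *
                ι (carlitzL F d) ^ (n + 1 - Fintype.card F ^ i + 1) := by
              rw [← pow_add]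
              congr 1
              lia
            rw [if_pos hd, ih _ (by lia), ← mul_gammaQuot F hn, carlitzECoeff, h2,
              ← map_pow _ (carlitzL F d) (Fintype.card F ^ i), ← h1]
            simp only [map_mul]
            field_simp
          · rw [if_neg hd, twistEval_atG_eq_zero F (by lia), map_zero, mul_zero, zero_mul]
        · rw [if_neg hn, if_neg hn, map_zero, map_zero, mul_zero, ite_self]
      rw [Finset.sum_congr rfl fun i _ => key i, Finset.sum_congr (s₁ := Finset.range (d + 1)) rfl
        fun i hi => (if_pos (e := (0 : RatFunc F))
          (Nat.lt_succ_iff.mp (Finset.mem_range.mp hi))).symm,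
        hS (n + 1) (n + d + 1) (by lia), hS (d + 1) (n + d + 1) (by lia)]
      · intro i hi'
        exact if_neg (by lia)
      · intro i hi'
        rw [if_neg (hi i hi'), mul_zero, ite_self]

lemma twistEval_eq_eval_swap (d : ℕ) (P : F[X][X]) :
    twistEval F d P = (Bivariate.swap P).eval (X ^ Fintype.card F ^ d) := by
  have h : twistEval F d = (evalRingHom (X ^ Fintype.card F ^ d)).comp
      (Bivariate.swap (R := F) : F[X][X] →+* F[X][X]) := by
    refine ringHom_ext' (ringHom_ext' (RingHom.ext fun c => ?_) ?_) ?_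
    · simpa [twistEval_C, Bivariate.swap_C_C] using (frobPow F F[X] d).commutes c
    · simp [twistEval_C, Bivariate.swap_X]
    · simp [twistEval_X, Bivariate.swap_Y]
  exact congrArg (· P) h

/-- After exchanging θ and t, the twisted values are the values of one polynomial at the infinitely
many points θ^{q^d}. -/
lemma eq_of_twistEval_eq {P Q : F[X][X]} (h : ∀ d, twistEval F d P = twistEval F d Q) : P = Q := by
  refine (Bivariate.swap (R := F)).injective (eq_of_infinite_eval_eq _ _ ?_)
  refine Set.infinite_of_injective_forall_mem (f := fun d : ℕ => (X : F[X]) ^ Fintype.card F ^ d)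
    (fun a b hab => card_pow_injective F ?_) fun d => ?_
  · simpa using congrArg natDegree hab
  · simpa [twistEval_eq_eval_swap] using h d

end AndersonThakur

/-! ### The absolute value on `ℂ_∞` -/

section Norm

variable (F : Type*) [Field F] [Fintype F] [DecidableEq (RatFunc F)]

lemma norm_embInfty (x : KInfty F) : ‖embInfty F x‖ = ‖x‖ :=
  (UniformSpace.Completion.norm_coe (algebraMap (KInfty F) (KInftyBar F) x)).trans
    (spectralNorm_extends x)

lemma isometry_embInfty : Isometry (embInfty F) :=
  AddMonoidHomClass.isometry_of_norm _ (norm_embInfty F)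

instance : IsUltrametricDist (KInftyBar F) :=
  IsUltrametricDist.isUltrametricDist_of_isNonarchimedean_norm
    (isNonarchimedean_spectralNorm (K := KInfty F) (L := KInftyBar F))

instance : IsUltrametricDist (CInfty F) := by
  refine IsUltrametricDist.isUltrametricDist_of_isNonarchimedean_norm fun x y => ?_
  induction x, y using UniformSpace.Completion.induction_on₂ with
  | hp => exact isClosed_le (by fun_prop) (by fun_prop)
  | ih x y =>
    rw [← UniformSpace.Completion.coe_add]
    simp only [UniformSpace.Completion.norm_coe]
    exact IsUltrametricDist.norm_add_le_max x y

lemma norm_algebraMap_KInfty {a : F[X]} (ha : a ≠ 0) :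
    ‖algebraMap (RatFunc F) (KInfty F) (algebraMap F[X] (RatFunc F) a)‖ =
      (Fintype.card F : ℝ) ^ a.natDegree := by
  let _ : Valued (RatFunc F) (WithZero (Multiplicative ℤ)) := RatFunc.inftyValued F
  have h : (Valued.v : Valuation (KInfty F) (WithZero (Multiplicative ℤ)))
      (algebraMap (RatFunc F) (KInfty F) (algebraMap F[X] (RatFunc F) a)) =
        WithZero.exp (a.natDegree : ℤ) :=
    (Valued.extensionValuation_apply_coe (algebraMap F[X] (RatFunc F) a)).trans
      (RatFunc.inftyValuation.polynomial F ha)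
  rw [Valued.toNormedField.norm_def]
  change ((WithZeroMulInt.toNNReal (one_lt_card_nnreal F).ne_zero
    (MonoidWithZeroHom.ValueGroup₀.embedding _) : NNReal) : ℝ) = _
  rw [Valuation.embedding_restrict, h, WithZeroMulInt.toNNReal_neg_apply _ WithZero.exp_ne_zero]
  exact congrArg NNReal.toReal (zpow_natCast (Fintype.card F : NNReal) a.natDegree) |>.trans
    (by push_cast; rfl)

lemma norm_embA {a : F[X]} (ha : a ≠ 0) : ‖embA F a‖ = (Fintype.card F : ℝ) ^ a.natDegree :=
  (norm_embInfty F _).trans (norm_algebraMap_KInfty F ha)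

lemma embA_injective : Function.Injective (embA F) :=
  (embK F).injective.comp (RatFunc.algebraMap_injective F)

lemma embA_ne_zero {a : F[X]} (ha : a ≠ 0) : embA F a ≠ 0 :=
  (map_ne_zero_iff _ (embA_injective F)).mpr ha

end Norm

/-! ### Evaluation of power series at `t = θ` -/

section Evaluation

variable {F : Type*} [Field F] [Fintype F] [DecidableEq (RatFunc F)]

lemma one_lt_card_real (F : Type*) [Field F] [Fintype F] : (1 : ℝ) < Fintype.card F := by
  exact_mod_cast Fintype.one_lt_card

variable (F) in
lemma norm_theta : ‖theta F‖ = Fintype.card F := by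
  rw [theta, norm_embA F X_ne_zero, natDegree_X, pow_one]

variable (F) in
lemma theta_ne_zero : theta F ≠ 0 := by
  rw [← norm_pos_iff, norm_theta]
  exact zero_lt_one.trans (one_lt_card_real F)

/-- The power series `f` converges absolutely at `t = θ`. -/
def AbsConvAtTheta (f : PowerSeries (CInfty F)) : Prop :=
  Summable fun i : ℕ => ‖PowerSeries.coeff i f * theta F ^ i‖

/-- The value of a power series at `t = θ`. -/
def thetaValue (f : PowerSeries (CInfty F)) : CInfty F :=
  ∑' i : ℕ, PowerSeries.coeff i f * theta F ^ i

lemma AbsConvAtTheta.hasValue {f : PowerSeries (CInfty F)} (h : AbsConvAtTheta f) :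
    HasValueAtTheta f (thetaValue f) :=
  (Summable.of_norm h).hasSum

lemma coeff_mul_mul_theta_pow (f g : PowerSeries (CInfty F)) (n : ℕ) :
    PowerSeries.coeff n (f * g) * theta F ^ n = ∑ p ∈ Finset.HasAntidiagonal.antidiagonal n,
      PowerSeries.coeff p.1 f * theta F ^ p.1 * (PowerSeries.coeff p.2 g * theta F ^ p.2) := by
  rw [PowerSeries.coeff_mul, Finset.sum_mul]
  refine Finset.sum_congr rfl fun p hp => ?_
  rw [← Finset.HasAntidiagonal.mem_antidiagonal.mp hp, pow_add]
  ring

lemma AbsConvAtTheta.mul {f g : PowerSeries (CInfty F)} (hf : AbsConvAtTheta f)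
    (hg : AbsConvAtTheta g) : AbsConvAtTheta (f * g) := by
  simpa only [AbsConvAtTheta, coeff_mul_mul_theta_pow] using
    summable_norm_sum_mul_antidiagonal_of_summable_norm hf hg

lemma thetaValue_mul {f g : PowerSeries (CInfty F)} (hf : AbsConvAtTheta f)
    (hg : AbsConvAtTheta g) : thetaValue (f * g) = thetaValue f * thetaValue g := by
  simp only [thetaValue, coeff_mul_mul_theta_pow]
  exact (tsum_mul_tsum_eq_tsum_sum_antidiagonal_of_summable_norm hf hg).symm

lemma absConvAtTheta_coe (P : (CInfty F)[X]) : AbsConvAtTheta (P : PowerSeries (CInfty F)) := by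
  refine summable_of_ne_finset_zero (s := P.support) fun i hi => ?_
  rw [Polynomial.coeff_coe, notMem_support_iff.mp hi, zero_mul, norm_zero]

lemma thetaValue_coe (P : (CInfty F)[X]) :
    thetaValue (P : PowerSeries (CInfty F)) = P.eval (theta F) := by
  rw [thetaValue, tsum_eq_sum (s := P.support), eval_eq_sum, Polynomial.sum]
  · simp
  · intro i hi
    rw [Polynomial.coeff_coe, notMem_support_iff.mp hi, zero_mul]

lemma AbsConvAtTheta.pow {f : PowerSeries (CInfty F)} (hf : AbsConvAtTheta f) (n : ℕ) :
    AbsConvAtTheta (f ^ n) := by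
  induction n with
  | zero => simpa using absConvAtTheta_coe (1 : (CInfty F)[X])
  | succ n ih => exact pow_succ f n ▸ ih.mul hf

lemma thetaValue_pow {f : PowerSeries (CInfty F)} (hf : AbsConvAtTheta f) (n : ℕ) :
    thetaValue (f ^ n) = thetaValue f ^ n := by
  induction n with
  | zero => simpa using thetaValue_coe (1 : (CInfty F)[X])
  | succ n ih => rw [pow_succ, pow_succ, thetaValue_mul (hf.pow n) hf, ih]

end Evaluation

/-! ### Twisting -/

section Twist

variable (F : Type*) [Field F] [Fintype F] [DecidableEq (RatFunc F)]

/-- The ring homomorphism `x ↦ x ^ q ^ d` of `ℂ_∞`. -/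
def frobCInfty (d : ℕ) : CInfty F →+* CInfty F :=
  letI : Algebra F (CInfty F) := ((embA F).comp C).toAlgebra
  (frobPow F (CInfty F) d : CInfty F →+* CInfty F)

@[simp]
lemma frobCInfty_apply (d : ℕ) (x : CInfty F) : frobCInfty F d x = x ^ Fintype.card F ^ d :=
  letI : Algebra F (CInfty F) := ((embA F).comp C).toAlgebra
  frobPow_apply d x

variable {F}

lemma twist_eq_map (d : ℕ) (f : PowerSeries (CInfty F)) :
    twist d f = PowerSeries.map (frobCInfty F d) f := by
  ext i
  simp [twist]

lemma twist_mul (d : ℕ) (f g : PowerSeries (CInfty F)) :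
    twist d (f * g) = twist d f * twist d g := by simp only [twist_eq_map, map_mul]

lemma twist_pow (d n : ℕ) (f : PowerSeries (CInfty F)) : twist d (f ^ n) = twist d f ^ n := by
  simp only [twist_eq_map, map_pow]

lemma twist_twist (d e : ℕ) (f : PowerSeries (CInfty F)) :
    twist d (twist e f) = twist (e + d) f := by
  ext i
  simp [twist, ← pow_mul, ← pow_add]

lemma twist_toSeries (d : ℕ) (P : F[X][X]) :
    twist d (toSeries P) = ((P.map (embA F)).map (frobCInfty F d) : (CInfty F)[X]) := by
  ext i
  simp [twist, toSeries]

lemma thetaValue_twist_toSeries (d : ℕ) (P : F[X][X]) :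
    thetaValue (twist d (toSeries P)) = embA F (twistEval F d P) := by
  rw [twist_toSeries, thetaValue_coe, twistEval, coe_eval₂RingHom, hom_eval₂, Polynomial.map_map,
    eval_map, ← theta]
  congr 1
  refine RingHom.ext fun a => ?_
  simp

end Twist

/-! ### The function `Ω` -/

section Omega

open scoped PowerSeries.WithPiTopology

variable {F : Type*} [Field F] [Fintype F] [DecidableEq (RatFunc F)]

/-- The coefficients of `f` are bounded by the powers of `c`. -/
def CoeffBounded (c : ℝ) (f : PowerSeries (CInfty F)) : Prop :=
  ∀ n, ‖PowerSeries.coeff n f‖ ≤ c ^ n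

lemma CoeffBounded.mul {c : ℝ} (hc : 0 ≤ c) {f g : PowerSeries (CInfty F)}
    (hf : CoeffBounded c f) (hg : CoeffBounded c g) : CoeffBounded c (f * g) := fun n => by
  rw [PowerSeries.coeff_mul]
  refine IsUltrametricDist.norm_sum_le_of_forall_le_of_nonneg (by positivity) fun p hp => ?_
  rw [norm_mul, ← Finset.HasAntidiagonal.mem_antidiagonal.mp hp, pow_add]
  exact mul_le_mul (hf _) (hg _) (norm_nonneg _) (by positivity)

lemma coeffBounded_one {c : ℝ} (hc : 0 ≤ c) : CoeffBounded c (1 : PowerSeries (CInfty F)) := by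
  intro n
  rw [PowerSeries.coeff_one]
  split_ifs with h
  · simp [h]
  · simpa using pow_nonneg hc n

lemma coeffBounded_one_sub_C_mul_X {c : ℝ} {a : CInfty F} (ha : ‖a‖ ≤ c) :
    CoeffBounded c (1 - PowerSeries.C a * PowerSeries.X) := by
  have hc : 0 ≤ c := (norm_nonneg a).trans ha
  intro n
  rw [map_sub, PowerSeries.coeff_one, PowerSeries.coeff_C_mul, PowerSeries.coeff_X]
  rcases n with _ | _ | n
  · simp
  · simpa using ha
  · simpa using pow_nonneg hc _

lemma coeffBounded_prod {c : ℝ} (hc : 0 ≤ c) {α : Type*} (s : Finset α)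
    {f : α → PowerSeries (CInfty F)} (h : ∀ i, CoeffBounded c (f i)) :
    CoeffBounded c (∏ i ∈ s, f i) := by
  classical
  induction s using Finset.induction_on with
  | empty => simpa using coeffBounded_one hc
  | insert a s ha ih =>
    rw [Finset.prod_insert ha]
    exact (h a).mul hc ih

/-- Expanded over finite sets of indices, each coefficient is dominated by a subseries of ∑ ∏ ‖a_i‖,
which converges. -/
lemma multipliable_one_sub_C_mul_X {a : ℕ → CInfty F} (ha : Summable fun i => ‖a i‖) :
    Multipliable fun i => (1 - PowerSeries.C (a i) * PowerSeries.X : PowerSeries (CInfty F)) := by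
  have h : Summable fun t : Finset ℕ => ∏ i ∈ t,
      (-(PowerSeries.C (a i) * PowerSeries.X) : PowerSeries (CInfty F)) := by
    rw [PowerSeries.WithPiTopology.summable_iff_summable_coeff]
    intro n
    have hs := summable_finsetProd_of_summable_nonneg (fun i => norm_nonneg (a i)) ha
    refine Summable.of_norm_bounded hs fun t => ?_
    have h1 : ∏ i ∈ t, (-(PowerSeries.C (a i) * PowerSeries.X) : PowerSeries (CInfty F)) =
        PowerSeries.C (∏ i ∈ t, -a i) * PowerSeries.X ^ t.card := by
      rw [map_prod, ← Finset.prod_const, ← Finset.prod_mul_distrib]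
      simp
    rw [h1, PowerSeries.coeff_C_mul, PowerSeries.coeff_X_pow]
    split_ifs
    · simp [norm_prod]
    · simpa using Finset.prod_nonneg fun i _ => norm_nonneg (a i)
  simpa only [sub_eq_add_neg] using multipliable_one_add_of_summable_prod h

lemma coeffBounded_tprod {c : ℝ} {a : ℕ → CInfty F} (hc : 0 ≤ c) (ha : Summable fun i => ‖a i‖)
    (hac : ∀ i, ‖a i‖ ≤ c) : CoeffBounded c
      (∏' i, (1 - PowerSeries.C (a i) * PowerSeries.X : PowerSeries (CInfty F))) := fun n =>
  le_of_tendsto (((PowerSeries.WithPiTopology.continuous_coeff (CInfty F) n).norm.tendsto _).comp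
    (multipliable_one_sub_C_mul_X ha).hasProd)
    (Filter.Eventually.of_forall fun s =>
      coeffBounded_prod hc s (fun i => coeffBounded_one_sub_C_mul_X (hac i)) n)

lemma constantCoeff_tprod {a : ℕ → CInfty F} (ha : Summable fun i => ‖a i‖) :
    PowerSeries.coeff 0
      (∏' i, (1 - PowerSeries.C (a i) * PowerSeries.X : PowerSeries (CInfty F))) = 1 := by
  rw [PowerSeries.coeff_zero_eq_constantCoeff_apply, (multipliable_one_sub_C_mul_X ha).map_tprod _
    (PowerSeries.WithPiTopology.continuous_constantCoeff (CInfty F))]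
  simp

variable (F) in
/-- The inverse roots `θ^{-q^{i+1}}` of `Ω`. -/
def omegaRoot (i : ℕ) : CInfty F := (theta F ^ Fintype.card F ^ (i + 1))⁻¹

variable (F) in
/-- The product `∏_{i ≥ 1} (1 - t / θ^{q^i})`. -/
def omegaProd : PowerSeries (CInfty F) :=
  ∏' i : ℕ, (1 - PowerSeries.C (omegaRoot F i) * PowerSeries.X)

variable (F) in
-- The exponent bound is q^{i+1} ≥ i + 2. The resulting q^{-2} decay of the coefficients of Ω beats
-- |θ|^n = q^n and leaves a factor q^{-n}.
lemma norm_omegaRoot_le (i : ℕ) :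
    ‖omegaRoot F i‖ ≤ ((Fintype.card F : ℝ)⁻¹) ^ 2 * ((Fintype.card F : ℝ)⁻¹) ^ i := by
  have hq := one_lt_card_real F
  rw [omegaRoot, norm_inv, norm_pow, norm_theta, ← pow_add, inv_pow]
  refine inv_anti₀ (by positivity) (pow_le_pow_right₀ hq.le ?_)
  have : i + 1 < Fintype.card F ^ (i + 1) := Nat.lt_pow_self Fintype.one_lt_card
  lia

variable (F) in
lemma summable_norm_omegaRoot : Summable fun i => ‖omegaRoot F i‖ :=
  Summable.of_nonneg_of_le (fun _ => norm_nonneg _) (norm_omegaRoot_le F)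
    ((summable_geometric_of_lt_one (by positivity)
      (inv_lt_one_of_one_lt₀ (one_lt_card_real F))).mul_left _)

variable (F) in
lemma norm_omegaRoot_le_sq (i : ℕ) : ‖omegaRoot F i‖ ≤ ((Fintype.card F : ℝ)⁻¹) ^ 2 :=
  (norm_omegaRoot_le F i).trans (mul_le_of_le_one_right (by positivity)
    (pow_le_one₀ (by positivity) (inv_lt_one_of_one_lt₀ (one_lt_card_real F)).le))

variable (F) in
lemma coeffBounded_omegaProd : CoeffBounded (((Fintype.card F : ℝ)⁻¹) ^ 2) (omegaProd F) :=
  coeffBounded_tprod (by positivity) (summable_norm_omegaRoot F) (norm_omegaRoot_le_sq F)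

lemma norm_coeff_mul_theta_pow_le {f : PowerSeries (CInfty F)} {B : ℝ}
    (n : ℕ) (h : ‖PowerSeries.coeff n f‖ ≤ B * (((Fintype.card F : ℝ)⁻¹) ^ 2) ^ n) :
    ‖PowerSeries.coeff n f * theta F ^ n‖ ≤ B * ((Fintype.card F : ℝ)⁻¹) ^ n := by
  have hq : (0 : ℝ) < Fintype.card F := zero_lt_one.trans (one_lt_card_real F)
  rw [norm_mul, norm_pow, norm_theta]
  refine (mul_le_mul_of_nonneg_right h (by positivity)).trans_eq ?_
  rw [mul_assoc, ← mul_pow, sq, mul_assoc, inv_mul_cancel₀ hq.ne', mul_one]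

lemma absConvAtTheta_of_coeff_le {f : PowerSeries (CInfty F)} {B : ℝ}
    (h : ∀ n, ‖PowerSeries.coeff n f‖ ≤ B * (((Fintype.card F : ℝ)⁻¹) ^ 2) ^ n) :
    AbsConvAtTheta f :=
  Summable.of_nonneg_of_le (fun _ => norm_nonneg _)
    (fun n => norm_coeff_mul_theta_pow_le n (h n))
    ((summable_geometric_of_lt_one (by positivity)
      (inv_lt_one_of_one_lt₀ (one_lt_card_real F))).mul_left _)

lemma omega_eq (θt : CInfty F) :
    omega θt = PowerSeries.C (θt ^ Fintype.card F)⁻¹ * omegaProd F := rfl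

lemma absConvAtTheta_twist_omega (θt : CInfty F) (d : ℕ) :
    AbsConvAtTheta (twist d (omega θt)) := by
  refine absConvAtTheta_of_coeff_le (B := ‖(θt ^ Fintype.card F)⁻¹‖ ^ Fintype.card F ^ d)
    fun n => ?_
  rw [twist, PowerSeries.coeff_mk, omega_eq, PowerSeries.coeff_C_mul, mul_pow, norm_mul, norm_pow]
  gcongr
  rw [norm_pow]
  have h1 : (((Fintype.card F : ℝ)⁻¹) ^ 2) ^ n ≤ 1 := by
    refine pow_le_one₀ (by positivity) (pow_le_one₀ (by positivity) ?_)
    exact (inv_lt_one_of_one_lt₀ (one_lt_card_real F)).le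
  refine (pow_le_pow_left₀ (norm_nonneg _) (coeffBounded_omegaProd F n) _).trans ?_
  -- Twisting raises the coefficient bound to the power q^d, which only shrinks it because it is at
  -- most 1.
  exact pow_le_of_le_one (by positivity) h1 (pow_pos (card_pos' F) d).ne'

lemma absConvAtTheta_omegaProd : AbsConvAtTheta (omegaProd F) :=
  absConvAtTheta_of_coeff_le (B := 1) fun n => (one_mul (_ : ℝ)).symm ▸ coeffBounded_omegaProd F n

variable (F) in
-- The constant term is 1 and the rest of the series has norm at most q⁻¹ < 1 by the ultrametric
-- inequality. Hence π̃ is a genuine inverse.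
lemma thetaValue_omegaProd_ne_zero : thetaValue (omegaProd F) ≠ 0 := by
  have hq := inv_lt_one_of_one_lt₀ (one_lt_card_real F)
  have hb n := norm_coeff_mul_theta_pow_le (B := 1) n (by simpa using coeffBounded_omegaProd F n)
  have hs : Summable fun n => PowerSeries.coeff n (omegaProd F) * theta F ^ n :=
    Summable.of_norm absConvAtTheta_omegaProd
  have h0 : PowerSeries.coeff 0 (omegaProd F) * theta F ^ 0 = 1 := by
    rw [pow_zero, mul_one]
    exact constantCoeff_tprod (summable_norm_omegaRoot F)
  have hlt : ‖∑' n, PowerSeries.coeff (n + 1) (omegaProd F) * theta F ^ (n + 1)‖ < 1 := by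
    refine (IsUltrametricDist.norm_tsum_le_of_forall_le_of_nonneg (by positivity) fun n =>
      (hb (n + 1)).trans ?_).trans_lt hq
    rw [one_mul]
    exact pow_le_of_le_one (by positivity) hq.le n.succ_ne_zero
  rw [thetaValue, hs.tsum_eq_zero_add, h0]
  intro h
  rw [add_eq_zero_iff_neg_eq] at h
  rw [← h, norm_neg, norm_one] at hlt
  exact lt_irrefl _ hlt

lemma theta_root_ne_zero {θt : CInfty F} (hθt : θt ^ (Fintype.card F - 1) = -theta F) :
    θt ≠ 0 := by
  rintro rfl
  rw [zero_pow (Nat.sub_pos_of_lt Fintype.one_lt_card).ne'] at hθt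
  exact theta_ne_zero F (neg_eq_zero.mp hθt.symm)

lemma thetaValue_omega_ne_zero {θt : CInfty F} (hθt : θt ^ (Fintype.card F - 1) = -theta F) :
    thetaValue (omega θt) ≠ 0 := by
  rw [omega_eq, ← Polynomial.coe_C, thetaValue_mul (absConvAtTheta_coe _) absConvAtTheta_omegaProd,
    thetaValue_coe, eval_C]
  exact mul_ne_zero (inv_ne_zero (pow_ne_zero _ (theta_root_ne_zero hθt)))
    (thetaValue_omegaProd_ne_zero F)

/-! ### Functional equation of Ω under twisting -/

variable (F) in
lemma omegaProd_eq_mul_twist : omegaProd F =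
    (1 - PowerSeries.C (omegaRoot F 0) * PowerSeries.X) * twist 1 (omegaProd F) := by
  have hcont : Continuous (PowerSeries.map (frobCInfty F 1)) := by
    refine continuous_iff_continuousAt.mpr fun f => ?_
    refine (PowerSeries.WithPiTopology.tendsto_iff_coeff_tendsto _ _ _ _).mpr fun n => ?_
    simp only [PowerSeries.coeff_map, frobCInfty_apply]
    exact ((PowerSeries.WithPiTopology.continuous_coeff (CInfty F) n).pow _).continuousAt
  rw [twist_eq_map, omegaProd, (multipliable_one_sub_C_mul_X
    (summable_norm_omegaRoot F)).map_tprod _ hcont]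
  have hmap (i : ℕ) : PowerSeries.map (frobCInfty F 1)
      (1 - PowerSeries.C (omegaRoot F i) * PowerSeries.X) =
      1 - PowerSeries.C (omegaRoot F (i + 1)) * PowerSeries.X := by
    simp [omegaRoot, ← pow_mul, ← pow_succ]
  simp only [hmap]
  have := Multipliable.prod_mul_tprod_nat_mul' (k := 1) (f := fun i =>
    (1 - PowerSeries.C (omegaRoot F i) * PowerSeries.X : PowerSeries (CInfty F)))
    (multipliable_one_sub_C_mul_X ((summable_nat_add_iff 1).mpr (summable_norm_omegaRoot F)))
  rw [← this, Finset.prod_range_one]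

lemma neg_pow_card (x : CInfty F) : (-x) ^ Fintype.card F = - x ^ Fintype.card F := by
  simpa using map_neg (frobCInfty F 1) x

lemma omega_eq_twist_mul {θt : CInfty F} (hθt : θt ^ (Fintype.card F - 1) = -theta F) :
    omega θt = twist 1 (omega θt) *
      (PowerSeries.X - PowerSeries.C (theta F ^ Fintype.card F)) := by
  have hθ := pow_ne_zero (Fintype.card F) (theta_ne_zero F)
  have h0 := pow_ne_zero (Fintype.card F) (theta_root_ne_zero hθt)
  -- From θ̃^q = -θ θ̃; this is where the choice of θ̃ as a (q-1)-th root of -θ enters.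
  have h1 : (θt ^ Fintype.card F) ^ Fintype.card F =
      -(θt ^ Fintype.card F * theta F ^ Fintype.card F) := by
    have hT : θt ^ Fintype.card F = θt * -theta F := by
      rw [← hθt, ← pow_succ', Nat.sub_add_cancel (card_pos' F)]
    conv_lhs => rw [hT, mul_pow, neg_pow_card, mul_neg]
  have hc : ((θt ^ Fintype.card F)⁻¹) ^ Fintype.card F * theta F ^ Fintype.card F =
      - (θt ^ Fintype.card F)⁻¹ := by
    rw [inv_pow, h1]
    field_simp
  have hc' : ((θt ^ Fintype.card F)⁻¹) ^ Fintype.card F =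
      - ((θt ^ Fintype.card F)⁻¹ * omegaRoot F 0) := by
    rw [inv_pow, h1, omegaRoot, zero_add, pow_one]
    field_simp
  have h2 : twist 1 (PowerSeries.C (θt ^ Fintype.card F)⁻¹ : PowerSeries (CInfty F)) =
      PowerSeries.C (((θt ^ Fintype.card F)⁻¹) ^ Fintype.card F) := by
    simp [twist_eq_map]
  have h3 : PowerSeries.C (((θt ^ Fintype.card F)⁻¹) ^ Fintype.card F) *
      (PowerSeries.X - PowerSeries.C (theta F ^ Fintype.card F)) =
      PowerSeries.C (θt ^ Fintype.card F)⁻¹ *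
        (1 - PowerSeries.C (omegaRoot F 0) * PowerSeries.X) := by
    rw [mul_sub, ← map_mul, hc, hc', map_neg, map_neg, map_mul]
    ring
  rw [omega_eq, twist_mul, h2, mul_right_comm, h3, mul_assoc, ← omegaProd_eq_mul_twist]

lemma omega_eq_twist_mul_prod {θt : CInfty F} (hθt : θt ^ (Fintype.card F - 1) = -theta F)
    (d : ℕ) : omega θt = twist d (omega θt) * ((∏ i ∈ Finset.range d,
      (X - C (theta F ^ Fintype.card F ^ (i + 1))) : (CInfty F)[X]) : PowerSeries (CInfty F)) := by
  induction d with
  | zero =>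
    ext
    simp [twist]
  | succ d ih =>
    have h : twist d (omega θt) = twist (d + 1) (omega θt) *
        ((X - C (theta F ^ Fintype.card F ^ (d + 1)) : (CInfty F)[X]) :
          PowerSeries (CInfty F)) := by
      conv_lhs => rw [omega_eq_twist_mul hθt]
      rw [twist_mul, twist_twist, add_comm 1 d]
      congr 1
      simp [twist_eq_map, ← pow_mul, pow_succ]
    rw [Finset.prod_range_succ, Polynomial.coe_mul, mul_comm (Polynomial.toPowerSeries _),
      ← mul_assoc,
      ← h, ← ih]

/-- At t = θ the product ∏ (t - θ^{q^i}) becomes 𝓛_d. -/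
lemma thetaValue_twist_omega_mul {θt : CInfty F}
    (hθt : θt ^ (Fintype.card F - 1) = -theta F) (d : ℕ) :
    thetaValue (twist d (omega θt)) * embA F (carlitzL F d) = thetaValue (omega θt) := by
  conv_rhs => rw [omega_eq_twist_mul_prod hθt d, thetaValue_mul (absConvAtTheta_twist_omega θt d)
    (absConvAtTheta_coe _), thetaValue_coe]
  rw [carlitzL_eq_prod_range, map_prod, eval_prod]
  simp [theta]

/-! ### The defining property of the Anderson–Thakur polynomials, algebraically -/

lemma hasValueAtTheta_twist {θt : CInfty F} (hθt : θt ^ (Fintype.card F - 1) = -theta F)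
    (d s : ℕ) (P : F[X][X]) : HasValueAtTheta (twist d (toSeries P * omega θt ^ s))
      (embA F (twistEval F d P) / (embA F (carlitzL F d) ^ s * piTilde θt ^ s)) := by
  have hL : embA F (carlitzL F d) ≠ 0 := embA_ne_zero F (carlitzL_ne_zero F d)
  have hP : AbsConvAtTheta (twist d (toSeries P)) := twist_toSeries d P ▸ absConvAtTheta_coe _
  have hO := absConvAtTheta_twist_omega θt d
  have h := (hP.mul (hO.pow s)).hasValue
  rw [thetaValue_mul hP (hO.pow s), thetaValue_pow hO, thetaValue_twist_toSeries,
    eq_div_of_mul_eq hL (thetaValue_twist_omega_mul hθt d), ← twist_pow, ← twist_mul] at h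
  convert h using 1
  rw [piTilde, ← thetaValue, div_pow, div_pow, one_pow, div_eq_mul_inv, mul_inv, inv_div, div_one,
    div_eq_mul_inv (thetaValue _ ^ s), mul_comm (_ ^ s)]

lemma isAndersonThakur_iff {θt : CInfty F} (hθt : θt ^ (Fintype.card F - 1) = -theta F)
    (H : ℕ → F[X][X]) : IsAndersonThakur θt H ↔ ∀ n, H n = atPoly F n := by
  have hπ : piTilde θt ≠ 0 := one_div_ne_zero (thetaValue_omega_ne_zero hθt)
  have key (d n : ℕ) : HasValueAtTheta (twist d (toSeries (H n) * omega θt ^ (n + 1)))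
      (embA F (carlitzGamma F (n + 1)) * embK F (powerSum F d (n + 1)) / piTilde θt ^ (n + 1)) ↔
      twistEval F d (H n) = twistEval F d (atPoly F n) := by
    have hL : embA F (carlitzL F d) ≠ 0 := embA_ne_zero F (carlitzL_ne_zero F d)
    have hp : embA F (twistEval F d (atPoly F n)) = embA F (carlitzGamma F (n + 1)) *
        embA F (carlitzL F d) ^ (n + 1) * embK F (powerSum F d (n + 1)) := by
      have h := congrArg (embK F) (twistEval_atPoly F d n)
      rw [map_mul, map_mul, map_pow] at h
      exact h
    have hy : embA F (carlitzGamma F (n + 1)) * embK F (powerSum F d (n + 1)) /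
        piTilde θt ^ (n + 1) = embA F (twistEval F d (atPoly F n)) /
          (embA F (carlitzL F d) ^ (n + 1) * piTilde θt ^ (n + 1)) := by
      rw [hp]
      field_simp
    rw [hy]
    constructor
    · intro h
      have h2 := (hasValueAtTheta_twist hθt d (n + 1) (H n)).unique h
      rw [div_left_inj' (mul_ne_zero (pow_ne_zero _ hL) (pow_ne_zero _ hπ))] at h2
      exact embA_injective F h2
    · intro h
      exact h ▸ hasValueAtTheta_twist hθt d (n + 1) (H n)
  constructor
  · intro h n
    exact eq_of_twistEval_eq F fun d => (key d n).mp (h d (n + 1) n.succ_pos)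
  · intro h d s hs
    obtain ⟨n, rfl⟩ := Nat.exists_eq_add_of_le' hs
    exact (key d n).mpr (by rw [h n])

end Omega

/-! ### Convergence -/

section Convergence

lemma summable_of_norm_le_geometric {E α : Type*} [NormedAddCommGroup E] [IsUltrametricDist E]
    [CompleteSpace E] {f : α → E} (w : α → ℕ) {B c : ℝ} (hc0 : 0 ≤ c) (hc : c < 1)
    (hw : ∀ N, {a | w a ≤ N}.Finite) (h : ∀ a, ‖f a‖ ≤ B * c ^ w a) : Summable f := by
  refine NonarchimedeanAddGroup.summable_of_tendsto_cofinite_zero ?_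
  have hw' : Filter.Tendsto w Filter.cofinite Filter.atTop := by
    refine Filter.tendsto_atTop.mpr fun N => ?_
    refine (hw N).subset fun a ha => ?_
    simp only [Set.mem_compl_iff, Set.mem_ofPred_eq, not_le] at ha ⊢
    exact ha.le
  refine squeeze_zero_norm h ?_
  simpa using ((tendsto_pow_atTop_nhds_zero_of_lt_one hc0 hc).comp hw').const_mul B

variable (F : Type*) [Field F] [Fintype F]

lemma finite_natDegree_le (N : ℕ) : {a : F[X] | a.natDegree ≤ N}.Finite := by
  refine Set.Finite.subset (s := (degreeLT F (N + 1) : Set F[X])) ?_ fun a ha => ?_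
  · have := Finite.of_equiv _ (degreeLTEquiv F (N + 1)).toEquiv.symm
    exact Set.toFinite _
  · exact mem_degreeLT.mpr (degree_le_natDegree.trans_lt (Nat.cast_lt.mpr (Nat.lt_succ_of_le ha)))

lemma finite_monicTuple_sum_le (r N : ℕ) :
    {a : MonicTuple F r | ∑ j, (a.1 j).natDegree ≤ N}.Finite := by
  refine Set.Finite.of_finite_image (f := Subtype.val) ?_ Subtype.val_injective.injOn
  refine (Set.Finite.pi' fun _ : Fin r => finite_natDegree_le F N).subset ?_
  rintro _ ⟨a, ha, rfl⟩ j
  exact (Finset.single_le_sum (fun _ _ => Nat.zero_le _) (Finset.mem_univ j)).trans ha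

lemma finite_strictAnti_sum_le (r N : ℕ) :
    {i : {i : Fin r → ℕ // StrictAnti i} | ∑ j, i.1 j ≤ N}.Finite := by
  refine Set.Finite.of_finite_image (f := Subtype.val) ?_ Subtype.val_injective.injOn
  refine (Set.Finite.pi' fun _ : Fin r => Set.finite_Iic N).subset ?_
  rintro _ ⟨a, ha, rfl⟩ j
  exact (Finset.single_le_sum (fun _ _ => Nat.zero_le _) (Finset.mem_univ j)).trans ha

lemma natDegree_carlitzL (n : ℕ) :
    (carlitzL F n).natDegree * (Fintype.card F - 1) + Fintype.card F =
      Fintype.card F ^ (n + 1) := by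
  induction n with
  | zero => simp [carlitzL_zero]
  | succ n ih =>
    have h1 : (X - X ^ Fintype.card F ^ (n + 1) : F[X]).natDegree = Fintype.card F ^ (n + 1) := by
      rw [natDegree_sub_eq_right_of_natDegree_lt] <;> simp only [natDegree_X, natDegree_X_pow]
      exact Nat.one_lt_pow n.succ_ne_zero Fintype.one_lt_card
    rw [carlitzL_succ, natDegree_mul (carlitzL_ne_zero F n), h1, add_mul, add_right_comm, ih,
      add_comm, ← Nat.mul_succ, Nat.succ_eq_add_one, Nat.sub_add_cancel (card_pos' F),
      ← pow_succ]
    exact fun h => (pow_pos (card_pos' F) (n + 1)).ne (by simpa [h] using h1)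

variable [DecidableEq (RatFunc F)]

lemma norm_embA_le (a : F[X]) : ‖embA F a‖ ≤ (Fintype.card F : ℝ) ^ a.natDegree := by
  rcases eq_or_ne a 0 with rfl | ha
  · simp
  · exact (norm_embA F ha).le

variable {F}

/-- Since (q - 1) deg 𝓛_i = q^{i+1} - q, the degree of the quotient is at most (sq - q^{i+1})/(q -
1). Then sq/(q - 1) ≤ 2s and q^{i+1}/(q - 1) ≥ q^i > i give the bound. -/
lemma norm_cmpl_factor_le {u : F[X]} {s : ℕ} (hs : 1 ≤ s)
    (hu : u.natDegree * (Fintype.card F - 1) ≤ (s - 1) * Fintype.card F) (i : ℕ) :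
    ‖embA F u ^ Fintype.card F ^ i / embA F (carlitzL F i) ^ s‖ ≤
      (Fintype.card F : ℝ) ^ (2 * s) * ((Fintype.card F : ℝ)⁻¹) ^ i := by
  have hq := one_lt_card_real F
  have hq0 : (0 : ℝ) < Fintype.card F := zero_lt_one.trans hq
  rw [norm_div, norm_pow, norm_pow, norm_embA F (carlitzL_ne_zero F i), inv_pow, ← div_eq_mul_inv,
    div_le_div_iff₀ (by positivity) (by positivity)]
  refine (mul_le_mul_of_nonneg_right (pow_le_pow_left₀ (norm_nonneg _) (norm_embA_le F u) _)
    (by positivity)).trans ?_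
  rw [← pow_mul, ← pow_mul, ← pow_add, ← pow_add]
  refine pow_le_pow_right₀ hq.le ?_
  -- Writing q = c + 2 and multiplying by q - 1 = c + 1 removes truncated subtraction and division.
  obtain ⟨c, hc⟩ := Nat.exists_eq_add_of_le' (Fintype.one_lt_card (α := F))
  have hL := natDegree_carlitzL F i
  have hi : i < Fintype.card F ^ i := Nat.lt_pow_self Fintype.one_lt_card
  obtain ⟨s, rfl⟩ := Nat.exists_eq_add_of_le' hs
  rw [pow_succ] at hL
  generalize Fintype.card F ^ i = Q at *
  generalize (carlitzL F i).natDegree = l at *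
  generalize u.natDegree = m at *
  rw [hc] at *
  simp only [Nat.succ_eq_add_one, Nat.reduceAdd, Nat.add_sub_cancel,
    show c + 2 - 1 = c + 1 from rfl] at *
  refine Nat.le_of_mul_le_mul_right (c := c + 1) ?_ c.succ_pos
  have h1 := Nat.mul_le_mul_right Q hu
  have h2 := congrArg (· * (s + 1)) hL
  have h3 := Nat.mul_le_mul_right (c + 1) hi.le
  nlinarith

variable (F)

lemma mzvTerm_norm_le {r : ℕ} {s : Fin r → ℕ} (hs : ∀ j, 1 ≤ s j) (a : MonicTuple F r) :
    ‖mzvTerm s a‖ ≤ 1 * ((Fintype.card F : ℝ)⁻¹) ^ ∑ j, (a.1 j).natDegree := by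
  have hq := one_lt_card_real F
  have hq0 : (0 : ℝ) < Fintype.card F := zero_lt_one.trans hq
  rw [mzvTerm, map_div₀, map_one, map_prod, norm_div, norm_one, norm_prod, one_mul, one_div,
    inv_pow, ← Finset.prod_pow_eq_pow_sum]
  refine inv_anti₀ (Finset.prod_pos fun j _ => by positivity)
    (Finset.prod_le_prod (fun j _ => by positivity) fun j _ => ?_)
  rw [map_pow, norm_pow, norm_algebraMap_KInfty F (a.2.1 j).ne_zero]
  exact le_self_pow₀ (one_le_pow₀ hq.le) (Nat.one_le_iff_ne_zero.mp (hs j))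

lemma summable_mzvTerm {r : ℕ} {s : Fin r → ℕ} (hs : ∀ j, 1 ≤ s j) :
    Summable fun a : MonicTuple F r => mzvTerm s a :=
  summable_of_norm_le_geometric (fun a => ∑ j, (a.1 j).natDegree) (by positivity)
    (inv_lt_one_of_one_lt₀ (one_lt_card_real F)) (finite_monicTuple_sum_le F r)
    (mzvTerm_norm_le F hs)

variable {F}

lemma cmplTerm_eq_prod {r : ℕ} (s : Fin r → ℕ) (z : Fin r → CInfty F)
    (i : {i : Fin r → ℕ // StrictAnti i}) : cmplTerm s z i =
      ∏ j, z j ^ Fintype.card F ^ i.1 j / embA F (carlitzL F (i.1 j)) ^ s j := by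
  rw [cmplTerm, Finset.prod_div_distrib]

lemma embA_mem_cmplDomain {r : ℕ} {s : Fin r → ℕ} (hs : ∀ j, 1 ≤ s j) {u : Fin r → F[X]}
    (hu : ∀ j, (u j).natDegree * (Fintype.card F - 1) ≤ (s j - 1) * Fintype.card F) :
    (fun j => embA F (u j)) ∈ cmplDomain F s := by
  refine summable_of_norm_le_geometric (fun i => ∑ j, i.1 j)
    (B := ∏ j, (Fintype.card F : ℝ) ^ (2 * s j)) (by positivity)
    (inv_lt_one_of_one_lt₀ (one_lt_card_real F)) (finite_strictAnti_sum_le r) fun i => ?_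
  rw [cmplTerm_eq_prod, norm_prod, ← Finset.prod_pow_eq_pow_sum, ← Finset.prod_mul_distrib]
  exact Finset.prod_le_prod (fun j _ => norm_nonneg _) fun j _ =>
    norm_cmpl_factor_le (hs j) (hu j) (i.1 j)

end Convergence

/-! ### Multizeta values as sums over degrees -/

section Multizeta

variable (F : Type*) [Field F] [Fintype F]

/-- Tuples of monic polynomials with decreasing degrees, sorted by their degrees. -/
def monicTupleEquiv (r : ℕ) :
    (Σ i : {i : Fin r → ℕ // StrictAnti i}, ∀ j, monicsOfDegree F (i.1 j)) ≃ MonicTuple F r :=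
  Equiv.ofBijective
    (fun p => ⟨fun j => (p.2 j).1, fun j => (mem_monicsOfDegree.mp (p.2 j).2).1, by
      simpa only [(mem_monicsOfDegree.mp (p.2 _).2).2] using p.1.2⟩) <| by
    constructor
    · rintro ⟨⟨i, hi⟩, a⟩ ⟨⟨i', hi'⟩, a'⟩ h
      have h' : ∀ j, (a j).1 = (a' j).1 := fun j => congrFun (congrArg Subtype.val h) j
      obtain rfl : i = i' := funext fun j =>
        (mem_monicsOfDegree.mp (a j).2).2.symm.trans
          ((congrArg natDegree (h' j)).trans (mem_monicsOfDegree.mp (a' j).2).2)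
      obtain rfl : a = a' := funext fun j => Subtype.ext (h' j)
      rfl
    · rintro ⟨a, ha, hd⟩
      exact ⟨⟨⟨_, hd⟩, fun j => ⟨a j, mem_monicsOfDegree.mpr ⟨ha j, rfl⟩⟩⟩, rfl⟩

variable [DecidableEq (RatFunc F)]

/-- The series is regrouped by the vector of degrees; each group is finite and factors as a product
of power sums. -/
lemma hasSum_prod_powerSum {r : ℕ} {s : Fin r → ℕ} (hs : ∀ j, 1 ≤ s j) :
    HasSum (fun i : {i : Fin r → ℕ // StrictAnti i} => ∏ j, embK F (powerSum F (i.1 j) (s j)))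
      (embInfty F (mzv F s)) := by
  have h1 : HasSum (embInfty F ∘ fun a : MonicTuple F r => mzvTerm s a) (embInfty F (mzv F s)) :=
    (summable_mzvTerm F hs).hasSum.map (embInfty F) (isometry_embInfty F).continuous
  refine ((monicTupleEquiv F r).hasSum_iff.mpr h1).sigma fun i => ?_
  have h2 : ∏ j, embK F (powerSum F (i.1 j) (s j)) =
      ∑ a : ∀ j, monicsOfDegree F (i.1 j),
        ∏ j, embK F (1 / algebraMap F[X] (RatFunc F) (a j) ^ s j) := by
    rw [← Fintype.piFinset_univ, ← Finset.prod_univ_sum (fun _ => Finset.univ)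
      (fun j (a : monicsOfDegree F (i.1 j)) => embK F (1 / algebraMap F[X] (RatFunc F) a ^ s j))]
    refine Finset.prod_congr rfl fun j _ => ?_
    rw [powerSum_eq_sum, map_sum, ← Finset.sum_coe_sort]
  rw [h2]
  convert hasSum_fintype _ using 2 with a
  simp only [Function.comp_apply, mzvTerm]
  rw [← map_prod, Finset.prod_div_distrib, Finset.prod_const_one]
  rfl

end Multizeta

/-! ### The formula for multizeta values -/

section Formula

variable {F : Type*} [Field F] [Fintype F] [DecidableEq (RatFunc F)]

lemma gamma_mul_powerSum {s : ℕ} (hs : 1 ≤ s) (d : ℕ) :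
    embA F (carlitzGamma F s) * embK F (powerSum F d s) =
      ∑ m ∈ Finset.range ((atPoly F (s - 1)).natDegree + 1), theta F ^ m *
        (embA F ((atPoly F (s - 1)).coeff m) ^ Fintype.card F ^ d /
          embA F (carlitzL F d) ^ s) := by
  have hL : embA F (carlitzL F d) ≠ 0 := embA_ne_zero F (carlitzL_ne_zero F d)
  obtain ⟨n, rfl⟩ := Nat.exists_eq_add_of_le' hs
  have h : embA F (twistEval F d (atPoly F n)) = embA F (carlitzGamma F (n + 1)) *
      embA F (carlitzL F d) ^ (n + 1) * embK F (powerSum F d (n + 1)) := by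
    have h := congrArg (embK F) (twistEval_atPoly F d n)
    rw [map_mul, map_mul, map_pow] at h
    exact h
  have h' : embA F (carlitzGamma F (n + 1)) * embK F (powerSum F d (n + 1)) =
      embA F (twistEval F d (atPoly F n)) / embA F (carlitzL F d) ^ (n + 1) := by
    rw [h]
    field_simp
  rw [h', Nat.add_sub_cancel, twistEval_apply, map_sum, Finset.sum_div]
  refine Finset.sum_congr rfl fun m _ => ?_
  rw [map_mul, map_pow, map_pow, ← theta]
  ring

lemma prod_gamma_mul_mzv {r : ℕ} {s : Fin r → ℕ} (hs : ∀ j, 1 ≤ s j)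
    (hu : ∀ m, (fun j => embA F (coeffPoint (atPoly F) s m j)) ∈ cmplDomain F s) :
    (∏ j, embA F (carlitzGamma F (s j))) * embInfty F (mzv F s) =
      ∑ m ∈ coeffIndex (atPoly F) s,
        theta F ^ (∑ j, m j) * cmpl s (fun j => embA F (coeffPoint (atPoly F) s m j)) := by
  have h1 := (hasSum_prod_powerSum F hs).mul_left (∏ j, embA F (carlitzGamma F (s j)))
  have h2 : HasSum (fun i => ∑ m ∈ coeffIndex (atPoly F) s, theta F ^ (∑ j, m j) *
        cmplTerm s (fun j => embA F (coeffPoint (atPoly F) s m j)) i)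
      (∑ m ∈ coeffIndex (atPoly F) s, theta F ^ (∑ j, m j) *
        cmpl s (fun j => embA F (coeffPoint (atPoly F) s m j))) :=
    hasSum_sum fun m _ => (Summable.hasSum (hu m)).mul_left _
  have h3 (i : {i : Fin r → ℕ // StrictAnti i}) :
      (∏ j, embA F (carlitzGamma F (s j))) * ∏ j, embK F (powerSum F (i.1 j) (s j)) =
        ∑ m ∈ coeffIndex (atPoly F) s, theta F ^ (∑ j, m j) *
          cmplTerm s (fun j => embA F (coeffPoint (atPoly F) s m j)) i := by
    rw [← Finset.prod_mul_distrib,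
      Finset.prod_congr rfl fun j _ => gamma_mul_powerSum (hs j) (i.1 j), Finset.prod_univ_sum]
    refine Finset.sum_congr rfl fun m _ => ?_
    rw [cmplTerm_eq_prod, Finset.prod_mul_distrib, Finset.prod_pow_eq_pow_sum]
    rfl
  simp only [h3] at h1
  exact h1.unique h2

end Formula

end CarlitzMPL
end

/-! ### The theorem -/

open CarlitzMPL in
theorem theorem5 (F : Type*) [Field F] [Fintype F] [DecidableEq (RatFunc F)]
    (θt : CInfty F) (hθt : θt ^ (Fintype.card F - 1) = -theta F) :
    (∃ H : ℕ → F[X][X], IsAndersonThakur θt H) ∧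
    ∀ H : ℕ → F[X][X], IsAndersonThakur θt H →
      -- `deg_θ H_n ≤ n q / (q - 1)`
      (∀ n m : ℕ, ((H n).coeff m).natDegree * (Fintype.card F - 1) ≤ n * Fintype.card F) ∧
      ∀ (r : ℕ) (s : Fin r → ℕ), (∀ j, 1 ≤ s j) →
        -- the multizeta series converges, and so do the polylogarithms at the points of `S`
        Summable (fun a : MonicTuple F r => mzvTerm s a) ∧
        (∀ m ∈ coeffIndex H s, (fun j => embA F (coeffPoint H s m j)) ∈ cmplDomain F s) ∧
        -- the formula
        embInfty F (mzv F s) =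
          (∏ j, embA F (carlitzGamma F (s j)))⁻¹ *
            ∑ m ∈ coeffIndex H s,
              theta F ^ (∑ j, m j) * cmpl s (fun j => embA F (coeffPoint H s m j)) ∧
        -- in particular, a `k`-linear combination of values at integral points
        embInfty F (mzv F s) ∈ Submodule.span (RatFunc F)
          {y : CInfty F | ∃ u : Fin r → F[X],
            (fun j => embA F (u j)) ∈ cmplDomain F s ∧ y = cmpl s (fun j => embA F (u j))} := by
  refine ⟨⟨atPoly F, (isAndersonThakur_iff hθt _).mpr fun _ => rfl⟩, fun H hH => ?_⟩
  -- By uniqueness, an arbitrary Anderson–Thakur sequence may be replaced by the constructed one.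
  obtain rfl : H = atPoly F := funext ((isAndersonThakur_iff hθt H).mp hH)
  refine ⟨fun n m => thetaDegreeLE_atPoly F n m, fun r s hs => ?_⟩
  have hu (m : Fin r → ℕ) :
      (fun j => embA F (coeffPoint (atPoly F) s m j)) ∈ cmplDomain F s :=
    embA_mem_cmplDomain hs fun j => thetaDegreeLE_atPoly F (s j - 1) (m j)
  have hΓ : ∏ j, embA F (carlitzGamma F (s j)) ≠ 0 :=
    Finset.prod_ne_zero_iff.mpr fun j _ => embA_ne_zero F (carlitzGamma_ne_zero F (s j))
  have hformula := (eq_inv_mul_iff_mul_eq₀ hΓ).mpr (prod_gamma_mul_mzv hs hu)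
  refine ⟨summable_mzvTerm F hs, fun m _ => hu m, hformula, ?_⟩
  rw [hformula, Finset.mul_sum]
  refine Submodule.sum_mem _ fun m _ => ?_
  -- The coefficients come from k, so each summand is a k-multiple of a polylogarithm value.
  have hcoef : (∏ j, embA F (carlitzGamma F (s j)))⁻¹ * theta F ^ (∑ j, m j) =
      embK F ((∏ j, algebraMap F[X] (RatFunc F) (carlitzGamma F (s j)))⁻¹ *
        algebraMap F[X] (RatFunc F) X ^ (∑ j, m j)) := by
    rw [map_mul, map_inv₀, map_prod, map_pow]
    rfl
  rw [← mul_assoc, hcoef]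
  exact Submodule.smul_mem _ _ (Submodule.subset_span ⟨_, hu m, rfl⟩)
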